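/- Let $V$ be an $s$-dimensional real vector space, $\Lambda\subset V$ a lattice spanning $V$, and $X=(a_1,\dots,a_N)$ a finite list (repetitions allowed) of non-zero elements of $\Lambda$ that spans $V$. A sublist $Y\subset X$ is a *cocircuit* if $X\setminus Y$ does not span $V$. A basis of $V$ extracted from $X$ is a sublist of $X$ that is a basis of $V$, and $\mathcal B(X)$ denotes the set of these (sublists being counted by their sets of indices). For $\underline b\in\mathcal B(X)$, $|\det \underline b|$ is the absolute value of the determinant of $\underline b$ in the coordinates of a $\mathbb Z$-basis of $\Lambda$. Put $\delta(X)=\sum_{\underline b\in\mathcal B(X)}|\det\underline b|$. Let $\mathbb C[\Lambda]$ be the group algebra with basis $e^a$, $a\in\Lambda$, and let $J_X\subset\mathbb C[\Lambda]$ be the ideal generated by the products $\prod_{a\in Y}(1-e^{-a})$ over all cocircuits $Y$ of $X$. Let $P(X)$ be the set of characters $\chi:\Lambda\to\mathbb C^*$ such that $\chi(a)=1$ for all $a$ in some basis $\underline b\in\mathcal B(X)$. For $\chi\in P(X)$ let $X_\chi$ be the sublist of all $a$ in $X$ with $\chi(a)=1$; let $A_{X_\chi}=S[V]/I_{X_\chi}$,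 where $S[V]$ is the symmetric algebra over $\mathbb C$ of $V\otimes_{\mathbb R}\mathbb C$ and $I_{X_\chi}$ is the ideal generated by the products $\prod_{a\in Y}a$ over all cocircuits $Y$ of $X_\chi$; and let $(\mathbb C[\Lambda]/J_X)_\chi$ be the localization of $\mathbb C[\Lambda]/J_X$ at the point $\chi$ of $\operatorname{Spec}\mathbb C[\Lambda]$. Then: 1. $P(X)$ is finite. For every $\chi\in P(X)$ and $a\in\Lambda$ the element $\chi(a)^{-1}e^a-1$ is nilpotent in $(\mathbb C[\Lambda]/J_X)_\chi$, and there is an isomorphism of $\mathbb C$-algebras (the logarithm isomorphism) $$L_\chi: A_{X_\chi}\xrightarrow{\ \sim\ }(\mathbb C[\Lambda]/J_X)_\chi,\qquad L_\chi(a)=\log\bigl(1+(\chi(a)^{-1}e^a-1)\bigr)\quad(a\in\Lambda),$$ where $\log(1+t)=t-t^2/2+t^3/3-\cdots$. 2. There is an isomorphism of $\mathbb C$-algebras $\Phi:\mathbb C[\Lambda]/J_X\cong\bigoplus_{\chi\in P(X)}A_{X_\chi}$ whose $\chi$-component, followed by $L_\chi$, is the localization map $\mathbb C[\Lambda]/J_X\to(\mathbb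 C[\Lambda]/J_X)_\chi$. 3. $\mathbb C[\Lambda]/J_X$ is finite dimensional and $\dim_{\mathbb C}\mathbb C[\Lambda]/J_X=\delta(X)$. 4. For $v\in\Lambda$ and $f:\Lambda\to\mathbb C$ let $(\nabla_vf)(u)=f(u)-f(u-v)$, and for a sublist $Y$ let $\nabla_Y=\prod_{a\in Y}\nabla_a$. The space $\nabla(X)=\{f:\Lambda\to\mathbb C\mid \nabla_Yf=0\text{ for all cocircuits }Y\text{ of }X\}$ is finite dimensional of dimension $\delta(X)$. -/

import Mathlib

open scoped TensorProduct

noncomputable section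

namespace ToricArrangement

/-! ### Difference operators -/

/-- The difference operator `(∇_v f)(u) = f u - f (u - v)` on complex functions on an additive
group. -/
def nabla {G : Type*} [AddCommGroup G] (v : G) : Module.End ℂ (G → ℂ) where
  toFun f := fun u => f u - f (u - v)
  map_add' f g := by
    funext u
    simp only [Pi.add_apply]
    ring
  map_smul' c f := by
    funext u
    simp only [Pi.smul_apply, smul_eq_mul, RingHom.id_apply]
    ring

theorem nabla_commute {G : Type*} [AddCommGroup G] (v w : G) :
    Commute (nabla v) (nabla w) := by
  refine LinearMap.ext fun f => funext fun u => ?_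
  simp only [Module.End.mul_apply, nabla, LinearMap.coe_mk, AddHom.coe_mk]
  rw [sub_right_comm u w v]
  ring

/-! ### Sublists of a list of lattice vectors -/

variable {V : Type*} [NormedAddCommGroup V] [NormedSpace ℝ V] {Λ : Submodule ℤ V} {ι : Type*}

/-! A list of lattice vectors is a family `X : ι → Λ`; a sublist is a set of indices, so that
repeated vectors count with their multiplicity. -/

/-- The sublist `Y` is a cocircuit of `X` if the vectors of `X` outside `Y` do not span `V`. -/
def IsCocircuit (X : ι → Λ) (Y : Finset ι) : Prop :=
  Submodule.span ℝ ((fun i => (X i : V)) '' {i | i ∉ Y}) ≠ ⊤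

/-- The sublist `b` is a basis of `V` extracted from `X`. -/
def IsExtractedBasis (X : ι → Λ) (b : Finset ι) : Prop :=
  LinearIndependent ℝ (fun i : b => (X i : V)) ∧
    Submodule.span ℝ ((fun i => (X i : V)) '' (b : Set ι)) = ⊤

/-! ### The group algebra side -/

/-- The element `e^a` of the group algebra `ℂ[Λ]`. -/
def expElt (a : Λ) : AddMonoidAlgebra ℂ Λ := AddMonoidAlgebra.single a 1

/-- The ideal `J_X` of `ℂ[Λ]` generated by the products `∏_{a ∈ Y} (1 - e^{-a})` over all
cocircuits `Y`. -/
def idealJ (X : ι → Λ) : Ideal (AddMonoidAlgebra ℂ Λ) :=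
  Ideal.span {p | ∃ Y : Finset ι, IsCocircuit X Y ∧ p = ∏ i ∈ Y, (1 - expElt (-X i))}

/-- The points of the torus are the characters `Λ → ℂ^*`. The points `P(X)` of the toric
arrangement are the characters that are trivial on some basis extracted from `X`. -/
def points (X : ι → Λ) : Set (AddChar Λ ℂ) :=
  {χ | ∃ b : Finset ι, IsExtractedBasis X b ∧ ∀ i ∈ b, χ (X i) = 1}

/-- Evaluation at the point `χ` of the torus: the algebra map with `e^a ↦ χ a`. -/
def evalAt (χ : AddChar Λ ℂ) : AddMonoidAlgebra ℂ Λ →ₐ[ℂ] ℂ :=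
  AddMonoidAlgebra.lift ℂ ℂ Λ χ.toMonoidHom

/-- The maximal ideal of `ℂ[Λ]` at the point `χ`. -/
def pointIdeal (χ : AddChar Λ ℂ) : Ideal (AddMonoidAlgebra ℂ Λ) :=
  RingHom.ker (evalAt χ)

instance pointIdeal_isPrime (χ : AddChar Λ ℂ) : (pointIdeal χ).IsPrime :=
  RingHom.ker_isPrime (evalAt χ)

/-- The algebra `ℂ[Λ]/J_X`. -/
abbrev QuotJ (X : ι → Λ) : Type _ := AddMonoidAlgebra ℂ Λ ⧸ idealJ X

/-- The localization of `ℂ[Λ]/J_X` at the point `χ`: the (classes of) functions that do not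
vanish at `χ` are inverted. -/
abbrev LocQuotJ (X : ι → Λ) (χ : AddChar Λ ℂ) : Type _ :=
  Localization ((pointIdeal χ).primeCompl.map (Ideal.Quotient.mk (idealJ X)))

/-! ### The symmetric algebra side -/

variable (V) in
/-- The complex polynomial functions on the dual of `V`: the symmetric algebra of the
complexification of `V`. -/
abbrev SymC : Type _ := SymmetricAlgebra ℂ (ℂ ⊗[ℝ] V)

/-- The vector `v`, as an element of degree one of the symmetric algebra. -/
def linElt (v : V) : SymC V := SymmetricAlgebra.ι ℂ (ℂ ⊗[ℝ] V) (1 ⊗ₜ[ℝ] v)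

/-- The ideal `I_X` generated by the products `∏_{a ∈ Y} a` over all cocircuits `Y`. -/
def idealI (X : ι → Λ) : Ideal (SymC V) :=
  Ideal.span {p | ∃ Y : Finset ι, IsCocircuit X Y ∧ p = ∏ i ∈ Y, linElt (X i : V)}

/-- The algebra `A_X = S[V]/I_X`. -/
abbrev AlgA (X : ι → Λ) : Type _ := SymC V ⧸ idealI X

/-- The sublist `X_χ` of the vectors of `X` on which the character `χ` takes the value `1`. -/
def subList (X : ι → Λ) (χ : AddChar Λ ℂ) : {i : ι // χ (X i) = 1} → Λ := fun i => X i

/-! ### The algebraic logarithm -/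

/-- `log (1 + t) = t - t²/2 + t³/3 - ⋯` for a nilpotent element `t` of a `ℂ`-algebra. -/
def logOneAdd {R : Type*} [CommRing R] [Algebra ℂ R] (t : R) : R :=
  ∑ k ∈ Finset.range (nilpotencyClass t), ((-1 : ℂ) ^ k / ((k : ℂ) + 1)) • t ^ (k + 1)

/-- The class of `χ(a)⁻¹ e^a - 1` in the localization of `ℂ[Λ]/J_X` at `χ`. -/
def unipotentPart (X : ι → Λ) (χ : AddChar Λ ℂ) (a : Λ) : LocQuotJ X χ :=
  algebraMap (QuotJ X) (LocQuotJ X χ)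
    (Ideal.Quotient.mk (idealJ X) ((χ a)⁻¹ • expElt a - 1))

/-! ### The number `δ(X)` -/

/-- `|det b|`: the absolute value of the determinant of the vectors of the sublist `b` in the
coordinates given by a basis `e` of the lattice (`0` if `b` has the wrong number of elements). -/
def absDet {s N : ℕ} (e : Module.Basis (Fin s) ℤ Λ) (X : Fin N → Λ) (b : Finset (Fin N)) : ℕ :=
  if h : b.card = s then
    (Matrix.det (e.toMatrix fun j : Fin s => X (b.orderEmbOfFin h j))).natAbs
  else 0

open scoped Classical in
/-- `δ(X) = ∑_b |det b|`, the sum over all bases `b` extracted from `X`. -/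
def delta {s N : ℕ} (e : Module.Basis (Fin s) ℤ Λ) (X : Fin N → Λ) : ℕ :=
  ∑ b : Finset (Fin N) with IsExtractedBasis X b, absDet e X b

/-! ### The space of solutions of the difference equations -/

/-- The product `∇_Y` of the commuting operators `∇_a`, `a ∈ Y`. -/
def nablaProd (X : ι → Λ) (Y : Finset ι) : Module.End ℂ (Λ → ℂ) :=
  Y.noncommProd (fun i => nabla (X i)) fun i _ j _ _ => nabla_commute (X i) (X j)

/-- The space `∇(X)` of the functions `f : Λ → ℂ` with `∇_Y f = 0` for all cocircuits `Y`. -/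
def solutions (X : ι → Λ) : Submodule ℂ (Λ → ℂ) :=
  ⨅ (Y : Finset ι) (_ : IsCocircuit X Y), LinearMap.ker (nablaProd X Y)

end ToricArrangement

end

/-! A prime containing `J_X` contains a factor `1 - e^{-a}` of every cocircuit product, so the
vectors with `e^a = 1` modulo the prime span `V` and contain an extracted basis. Hence each `e^a`
satisfies `(e^a)^m = 1` up to nilpotents, for one common `m`. So `ℂ[Λ]/J_X` is finite dimensional,
all its primes are points of `P(X)`, and it is the product of its localizations there
(`equivPiLoc`).

At a point `χ` the factors `1 - e^{-a}` with `χ(a) ≠ 1` are units, so only the cocircuits of `X_χ`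
matter. For the other factors, `1 - exp(-a)` is `a` times a unit, and `log(1 + t)` is `t` times a
unit. Thus `e^a ↦ χ(a) exp(a)` and `a ↦ log(χ(a)⁻¹ e^a)` respect the two ideals and are inverse to
each other (`exists_logEquiv`).

The dimension of `A_X` is the number of bases extracted from `X`. The upper bound is a
deletion-contraction induction (`rank_le_card_basesIn`). For the lower bound, the linear forms are
translated by generic constants: the deformed ideal vanishes at one point for each basis, and the
passage to leading forms cannot decrease the dimension (`card_basesIn_le`). Summing over `χ` counts
the pairs `(χ, b)` with `χ` trivial on `b`. A basis `b` occurs `|Λ/⟨b⟩| = |det b|` times, which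
gives `δ(X)`.

Finally `∇_a` is the transpose of multiplication by `1 - e^{-a}`, so `∇(X)` is the linear dual of
`ℂ[Λ]/J_X`. -/

noncomputable section

namespace ToricArrangement

/-! ### Upper bound for the dimension by deletion and contraction -/

section RankBound

universe u v
variable {ι : Type*} {k : Type*} {K : Type*} [Field k] [Field K] {σ : k →+* K}

open scoped Classical in
/-- The bases extracted from the members of `S`. -/
def basesIn (k : Type*) [Field k] {W : Type*} [AddCommGroup W] [Module k W] (x : ι → W)
    (S : Finset ι) : Finset (Finset ι) :=
  {b ∈ S.powerset | LinearIndepOn k x (b : Set ι) ∧ Submodule.span k (x '' (b : Set ι)) = ⊤}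

theorem mem_basesIn {W : Type*} [AddCommGroup W] [Module k W] {x : ι → W} {S b : Finset ι} :
    b ∈ basesIn k x S ↔ b ⊆ S ∧ LinearIndepOn k x (b : Set ι) ∧
      Submodule.span k (x '' (b : Set ι)) = ⊤ := by
  simp [basesIn]

theorem span_insert_eq_top_iff {W : Type*} [AddCommGroup W] [Module k W] (x : ι → W) (y : ι)
    (T : Set ι) :
    Submodule.span k (x '' insert y T) = ⊤ ↔
      Submodule.span k (((Submodule.span k {x y}).mkQ ∘ x) '' T) = ⊤ := by
  rw [Set.image_comp, Submodule.span_image, Submodule.map_mkQ_eq_top, Set.image_insert_eq,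
    Submodule.span_insert]

/-- Multiplication by `z` identifies the ideal `(z)` with `R / Ann z`. This is the exact sequence
behind deletion and contraction. -/
theorem rank_eq_add_rank_quotient {R : Type v} [CommRing R] [Algebra K R] (z : R) :
    Module.rank K R = Module.rank K (R ⧸ Ideal.span {z}) +
      Module.rank K (R ⧸ Ideal.torsionOf R R z) := by
  rw [← Submodule.rank_quotient_add_rank ((Ideal.span {z}).restrictScalars K)]
  congr 1
  exact (((Ideal.quotTorsionOfEquivSpanSingleton R R z).restrictScalars K).rank_eq).symm

theorem insert_mem_basesIn [DecidableEq ι] {W : Type*} [AddCommGroup W] [Module k W] {x : ι → W}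
    {S : Finset ι} {y : ι} (hxy : x y ≠ 0) {b : Finset ι}
    (hb : b ∈ basesIn k ((Submodule.span k {x y}).mkQ ∘ x) S) :
    insert y b ∈ basesIn k x (insert y S) := by
  rw [mem_basesIn] at hb ⊢
  refine ⟨Finset.insert_subset_insert y hb.1, ?_, ?_⟩
  · have h1 : LinearIndepOn k x {y} := by simpa [linearIndepOn_singleton_iff] using hxy
    have h2 := LinearIndepOn.union_of_quotient (t := (b : Set ι)) h1
      (by rw [Set.image_singleton]; exact hb.2.1)
    simpa [Set.singleton_union] using h2
  · rw [Finset.coe_insert, span_insert_eq_top_iff]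
    exact hb.2.2

/-- Adding `y` turns bases of the contraction into bases containing `y`; bases of the deletion are
those avoiding `y`. Only this inequality is needed for the upper bound. -/
theorem card_basesIn_add_le [DecidableEq ι] {W : Type*} [AddCommGroup W] [Module k W] {x : ι → W}
    {S : Finset ι} {y : ι} (hy : y ∉ S) (hxy : x y ≠ 0) :
    (basesIn k ((Submodule.span k {x y}).mkQ ∘ x) S).card + (basesIn k x S).card ≤
      (basesIn k x (insert y S)).card := by
  have hinj : Set.InjOn (insert y)
      (basesIn k ((Submodule.span k {x y}).mkQ ∘ x) S : Set (Finset ι)) := by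
    intro b hb c hc hbc
    have hb' : y ∉ b := fun h => hy ((mem_basesIn.1 hb).1 h)
    have hc' : y ∉ c := fun h => hy ((mem_basesIn.1 hc).1 h)
    rw [← Finset.erase_insert hb', ← Finset.erase_insert hc', hbc]
  rw [← Finset.card_image_of_injOn hinj, ← Finset.card_union_of_disjoint]
  · refine Finset.card_le_card (Finset.union_subset ?_ ?_)
    · intro b hb
      obtain ⟨c, hc, rfl⟩ := Finset.mem_image.1 hb
      exact insert_mem_basesIn hxy hc
    · intro b hb
      rw [mem_basesIn] at hb ⊢
      exact ⟨hb.1.trans (Finset.subset_insert y S), hb.2⟩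
  · rw [Finset.disjoint_left]
    intro b hb hb'
    obtain ⟨c, hc, rfl⟩ := Finset.mem_image.1 hb
    exact hy ((mem_basesIn.1 hb').1 (Finset.mem_insert_self y c))

theorem adjoin_range_mk_eq_top {W R : Type*} [CommRing R] [Algebra K R] {f : W → R}
    (hf : Algebra.adjoin K (Set.range f) = ⊤) (I : Ideal R) :
    Algebra.adjoin K (Set.range (Ideal.Quotient.mk I ∘ f)) = ⊤ := by
  have h := AlgHom.map_adjoin (Ideal.Quotient.mkₐ K I) (Set.range f)
  rw [hf, Algebra.map_top, ← Set.range_comp,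
    (AlgHom.range_eq_top _).2 (Ideal.Quotient.mkₐ_surjective K I)] at h
  exact h.symm

/-- A commutative algebra generated by a vector space in which the products over the cocircuits
of a finite list of vectors vanish has at most as many dimensions as the list has bases. -/
theorem rank_le_card_basesIn (S : Finset ι) :
    ∀ {W : Type u} [AddCommGroup W] [Module k W] {R : Type v} [CommRing R] [Algebra K R]
      (x : ι → W) (f : W →ₛₗ[σ] R) (_ : Algebra.adjoin K (Set.range f) = ⊤)
      (_ : ∀ Y ⊆ S, Submodule.span k (x '' ((S : Set ι) \ Y)) ≠ ⊤ → ∏ i ∈ Y, f (x i) = 0),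
      Module.rank K R ≤ (basesIn k x S).card := by
  classical
  induction S using Finset.induction_on with
  | empty =>
    intro W _ _ R _ _ x f hgen hY
    -- Either `W = 0`, and `R` is generated by `f 0 = 0`, or the empty set is a cocircuit, and its
    -- empty product gives `1 = 0`.
    by_cases h : Submodule.span k (x '' ∅) = ⊤
    · have hW : Subsingleton W := by
        rw [Set.image_empty, Submodule.span_empty] at h
        exact Submodule.subsingleton_iff k |>.1 (subsingleton_of_bot_eq_top h)
      have hsurj : Function.Surjective (Algebra.linearMap K R) := by
        intro r
        have hr : r ∈ Algebra.adjoin K (Set.range f) := hgen ▸ Algebra.mem_top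
        have h0 : Set.range f ⊆ ((⊥ : Subalgebra K R) : Set R) := by
          rintro _ ⟨w, rfl⟩
          rw [Subsingleton.elim w 0, map_zero]
          exact zero_mem _
        exact Algebra.mem_bot.1 (Algebra.adjoin_le h0 hr)
      have hmem : ∅ ∈ basesIn k x ∅ := by
        rw [mem_basesIn]
        exact ⟨subset_rfl, by simp, by simpa using h⟩
      calc Module.rank K R ≤ 1 := by
            rw [rank_le_one_iff]
            refine ⟨1, fun r => ?_⟩
            obtain ⟨c, rfl⟩ := hsurj r
            exact ⟨c, (Algebra.algebraMap_eq_smul_one c).symm⟩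
        _ ≤ _ := by exact_mod_cast Finset.card_pos.2 ⟨_, hmem⟩
    · have h1 : (1 : R) = 0 := by simpa using hY ∅ subset_rfl (by simpa using h)
      have : Subsingleton R := subsingleton_of_zero_eq_one h1.symm
      simp
  | insert y S hyS ih =>
    intro W _ _ R _ _ x f hgen hY
    by_cases hxy : x y = 0
    · refine (ih x f hgen ?_).trans ?_
      · intro Y hYS hsp
        refine hY Y (hYS.trans (Finset.subset_insert y S)) ?_
        rw [Finset.coe_insert, Set.insert_sdiff_of_notMem _ (fun h => hyS (hYS h)),
          Set.image_insert_eq, hxy, Submodule.span_insert_zero]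
        exact hsp
      · refine Nat.cast_le.2 (Finset.card_le_card fun b hb => ?_)
        rw [mem_basesIn] at hb ⊢
        exact ⟨hb.1.trans (Finset.subset_insert y S), hb.2⟩
    -- With `z = f (x y)`, the ring `R/(z)` is generated by `W/⟨x y⟩` and belongs to the
    -- contraction. The ring `R/Ann z` belongs to the deletion: if `Y` is a cocircuit of `S`, then
    -- `insert y Y` is one of `insert y S`, so `z` kills the product over `Y`.
    · rw [rank_eq_add_rank_quotient (f (x y))]
      refine le_trans (add_le_add
        (ih ((Submodule.span k {x y}).mkQ ∘ x) ((Submodule.span k {x y}).liftQ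
          ((Ideal.Quotient.mkₐ K (Ideal.span {f (x y)})).toLinearMap.comp f) ?_) ?_ ?_)
        (ih x ((Ideal.Quotient.mkₐ K (Ideal.torsionOf R R (f (x y)))).toLinearMap.comp f)
          ?_ ?_)) (by exact_mod_cast card_basesIn_add_le hyS hxy)
      · rw [Submodule.span_singleton_le_iff_mem, LinearMap.mem_ker]
        exact Ideal.Quotient.eq_zero_iff_mem.2 (Ideal.mem_span_singleton_self _)
      · rw [← adjoin_range_mk_eq_top hgen (Ideal.span {f (x y)})]
        congr 1
        ext r
        constructor
        · rintro ⟨w, rfl⟩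
          obtain ⟨w, rfl⟩ := Submodule.mkQ_surjective _ w
          exact ⟨w, rfl⟩
        · rintro ⟨w, rfl⟩
          exact ⟨Submodule.mkQ _ w, rfl⟩
      · intro Y hYS hsp
        have h0 : ∏ i ∈ Y, f (x i) = 0 := by
          refine hY Y (hYS.trans (Finset.subset_insert y S)) ?_
          rw [Finset.coe_insert, Set.insert_sdiff_of_notMem _ (fun h => hyS (hYS h)), Ne,
            span_insert_eq_top_iff]
          exact hsp
        have h1 := congrArg (Ideal.Quotient.mk (Ideal.span {f (x y)})) h0
        rw [map_prod, map_zero] at h1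
        exact h1
      · exact adjoin_range_mk_eq_top hgen _
      · intro Y hYS hsp
        have hyY : y ∉ Y := fun h => hyS (hYS h)
        have h0 : ∏ i ∈ insert y Y, f (x i) = 0 := by
          refine hY _ (Finset.insert_subset_insert y hYS) ?_
          have hSY : (↑(insert y S) \ ↑(insert y Y) : Set ι) = ↑S \ ↑Y := by
            ext i
            simp only [Finset.coe_insert, Set.mem_sdiff, Set.mem_insert_iff, Finset.mem_coe]
            grind
          rwa [hSY]
        rw [Finset.prod_insert hyY] at h0
        have h1 : Ideal.Quotient.mk (Ideal.torsionOf R R (f (x y))) (∏ i ∈ Y, f (x i)) = 0 := by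
          rw [Ideal.Quotient.eq_zero_iff_mem, Ideal.mem_torsionOf_iff, smul_eq_mul, mul_comm]
          exact h0
        rw [map_prod] at h1
        exact h1

end RankBound

/-! ### Deforming homogeneous ideals, and counting points -/

section LeadingForms

open MvPolynomial

variable {τ K J : Type*} [Field K]

/-- The polynomials of degree less than `n`. -/
def lowDegree (τ K : Type*) [Field K] (n : ℕ) : Submodule K (MvPolynomial τ K) :=
  Submodule.span K {p | ∃ m < n, p.IsHomogeneous m}

theorem mul_mem_lowDegree {m n : ℕ} {p q : MvPolynomial τ K} (hp : p.IsHomogeneous m)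
    (hq : q ∈ lowDegree τ K n) : p * q ∈ lowDegree τ K (m + n) := by
  induction hq using Submodule.span_induction with
  | mem q h =>
    obtain ⟨l, hl, hq⟩ := h
    exact Submodule.subset_span ⟨m + l, by omega, hp.mul hq⟩
  | zero => simp
  | add q r _ _ hq hr => rw [mul_add]; exact add_mem hq hr
  | smul c q _ hq => rw [mul_smul_comm]; exact Submodule.smul_mem _ c hq

theorem prod_sub_C_sub_prod_mem_lowDegree {ι : Type*} {l : ι → MvPolynomial τ K}
    (hl : ∀ i, (l i).IsHomogeneous 1) (c : ι → K) (Y : Finset ι) :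
    ∏ i ∈ Y, (l i - C (c i)) - ∏ i ∈ Y, l i ∈ lowDegree τ K Y.card := by
  classical
  induction Y using Finset.induction_on with
  | empty => simp
  | insert a Y ha ih =>
    have hc : C (c a) * ∏ i ∈ Y, l i ∈ lowDegree τ K (insert a Y).card := by
      refine Submodule.subset_span ⟨Y.card, by simp [ha], ?_⟩
      simpa using (isHomogeneous_C τ (c a)).mul (IsHomogeneous.prod Y l (fun _ => 1) fun i _ => hl i)
    have h1 := mul_mem_lowDegree (hl a) ih
    have h2 := mul_mem_lowDegree (isHomogeneous_C τ (c a)) ih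
    rw [Finset.card_insert_of_notMem ha] at hc ⊢
    rw [add_comm] at h1
    have h3 : lowDegree τ K (0 + Y.card) ≤ lowDegree τ K (Y.card + 1) :=
      Submodule.span_mono fun p ⟨m, hm, hp⟩ => ⟨m, by omega, hp⟩
    rw [Finset.prod_insert ha, Finset.prod_insert ha]
    convert sub_mem (sub_mem h1 (h3 h2)) hc using 1
    ring

/-- If some monomials span the polynomials modulo an ideal generated by homogeneous elements, then
they do so modulo every ideal generated by elements with these leading forms. -/
theorem span_monomial_sup_eq_top {g g' : J → MvPolynomial τ K} {d : J → ℕ}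
    (hg : ∀ j, (g j).IsHomogeneous (d j)) (hg' : ∀ j, g' j - g j ∈ lowDegree τ K (d j))
    {κ : Type*} (a : κ → τ →₀ ℕ)
    (h : (Ideal.span (Set.range g)).restrictScalars K ⊔
      Submodule.span K (Set.range fun i => monomial (a i) (1 : K)) = ⊤) :
    (Ideal.span (Set.range g')).restrictScalars K ⊔
      Submodule.span K (Set.range fun i => monomial (a i) (1 : K)) = ⊤ := by
  set T := (Ideal.span (Set.range g')).restrictScalars K ⊔
      Submodule.span K (Set.range fun i => monomial (a i) (1 : K)) with hT
  -- Induction on the degree: write `p` as a combination of the `g j` plus monomials, keep only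
  -- degree `n`, and replace each `g j` by `g' j`. The error has lower degree.
  have key : ∀ n, ∀ p : MvPolynomial τ K, p.IsHomogeneous n → p ∈ T := by
    intro n
    induction n using Nat.strong_induction_on with
    | _ n ih =>
    have hlow : lowDegree τ K n ≤ T := Submodule.span_le.2 fun p ⟨m, hm, hp⟩ => ih m hm p hp
    have hmul : ∀ k j (q : MvPolynomial τ K), q.IsHomogeneous k →
        homogeneousComponent n (q * g j) ∈ T := by
      intro k j q hq
      rw [homogeneousComponent_of_mem (hq.mul (hg j))]
      split_ifs with hn
      · have h1 : q * g' j ∈ T := Submodule.mem_sup_left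
          (Ideal.mul_mem_left _ q (Ideal.subset_span ⟨j, rfl⟩))
        have h2 : q * (g' j - g j) ∈ T := hlow (hn ▸ mul_mem_lowDegree hq (hg' j))
        convert sub_mem h1 h2 using 1
        ring
      · exact zero_mem _
    intro p hp
    obtain ⟨r, hr, w, hw, rfl⟩ := Submodule.mem_sup.1 (h ▸ Submodule.mem_top : p ∈ _)
    rw [← homogeneousComponent_eq_self hp, map_add]
    refine add_mem ?_ (Submodule.mem_sup_right ?_)
    · obtain ⟨c, rfl⟩ := Finsupp.mem_ideal_span_range_iff_exists_finsupp.1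
        ((Submodule.restrictScalars_mem _ _ _).1 hr)
      rw [Finsupp.sum, map_sum]
      refine sum_mem fun j _ => ?_
      rw [← sum_homogeneousComponent (c j), Finset.sum_mul, map_sum]
      exact sum_mem fun k _ => hmul k j _ (homogeneousComponent_isHomogeneous k (c j))
    · refine (Submodule.map_span_le (homogeneousComponent n) _ _).2 ?_
        (Submodule.mem_map_of_mem hw)
      rintro _ ⟨i, rfl⟩
      rw [homogeneousComponent_of_mem (isHomogeneous_monomial (1 : K) rfl)]
      split_ifs
      · exact Submodule.subset_span ⟨i, rfl⟩
      · exact zero_mem _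
  refine Submodule.eq_top_iff'.2 fun p => ?_
  rw [← sum_homogeneousComponent p]
  exact sum_mem fun n _ => key n _ (homogeneousComponent_isHomogeneous n p)

theorem span_mk_eq_top_iff {R κ : Type*} [CommRing R] [Algebra K R] (I : Ideal R) (v : κ → R) :
    Submodule.span K (Set.range fun i => Ideal.Quotient.mk I (v i)) = ⊤ ↔
      I.restrictScalars K ⊔ Submodule.span K (Set.range v) = ⊤ := by
  have h1 : (Set.range fun i => Ideal.Quotient.mk I (v i)) =
      (Ideal.Quotient.mkₐ K I).toLinearMap '' Set.range v := by
    rw [← Set.range_comp]; rfl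
  have h2 : LinearMap.ker (Ideal.Quotient.mkₐ K I).toLinearMap = I.restrictScalars K := by
    ext x
    simp [Ideal.Quotient.eq_zero_iff_mem]
  rw [h1, Submodule.span_image, ← h2, sup_comm, ← Submodule.comap_map_eq]
  constructor
  · intro h; rw [h, Submodule.comap_top]
  · intro h
    have hs : Function.Surjective (Ideal.Quotient.mkₐ K I).toLinearMap :=
      Ideal.Quotient.mkₐ_surjective K I
    rw [← Submodule.map_comap_eq_of_surjective hs (Submodule.map _ _), h, Submodule.map_top,
      LinearMap.range_eq_top.2 hs]

/-- Monomials forming a basis modulo the `g j` still span modulo the `g' j`. They may become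
dependent there, hence only an inequality. -/
theorem finite_quotient_of_leading {g g' : J → MvPolynomial τ K} {d : J → ℕ}
    (hg : ∀ j, (g j).IsHomogeneous (d j)) (hg' : ∀ j, g' j - g j ∈ lowDegree τ K (d j))
    [Module.Finite K (MvPolynomial τ K ⧸ Ideal.span (Set.range g))] :
    Module.Finite K (MvPolynomial τ K ⧸ Ideal.span (Set.range g')) ∧
      Module.finrank K (MvPolynomial τ K ⧸ Ideal.span (Set.range g')) ≤
        Module.finrank K (MvPolynomial τ K ⧸ Ideal.span (Set.range g)) := by
  obtain ⟨κ, a, -, hsp, hli⟩ := exists_linearIndependent' K fun m : τ →₀ ℕ =>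
    Ideal.Quotient.mk (Ideal.span (Set.range g)) (monomial m (1 : K))
  have htop : (Ideal.span (Set.range g)).restrictScalars K ⊔
      Submodule.span K (Set.range fun m : τ →₀ ℕ => monomial m (1 : K)) = ⊤ := by
    refine eq_top_iff.2 (le_trans ?_ le_sup_right)
    rw [← (basisMonomials τ K).span_eq, coe_basisMonomials]
  rw [(span_mk_eq_top_iff _ _).2 htop] at hsp
  have hsp' := (span_mk_eq_top_iff _ _).2
    (span_monomial_sup_eq_top hg hg' a ((span_mk_eq_top_iff _ _).1 hsp))
  have hfin : Finite κ := hli.finite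
  have := Fintype.ofFinite κ
  refine ⟨⟨hsp' ▸ Submodule.fg_span (Set.finite_range _)⟩, ?_⟩
  rw [Module.finrank_eq_card_basis (Module.Basis.mk hli hsp.ge)]
  have h := finrank_range_le_card (R := K)
    fun i => Ideal.Quotient.mk (Ideal.span (Set.range g')) (monomial (a i) (1 : K))
  rwa [Set.finrank, hsp', finrank_top] at h

/-- Evaluations at distinct points are distinct algebra maps to `K`, hence linearly independent in
the dual of the quotient. -/
theorem card_le_finrank_of_aeval_eq_zero {β : Type*} [Fintype β] {q : β → τ → K}
    (hq : Function.Injective q) {I : Ideal (MvPolynomial τ K)}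
    [Module.Finite K (MvPolynomial τ K ⧸ I)] (h : ∀ b, ∀ p ∈ I, aeval (q b) p = 0) :
    Fintype.card β ≤ Module.finrank K (MvPolynomial τ K ⧸ I) := by
  have hinj : Function.Injective fun b => Ideal.Quotient.liftₐ I (aeval (q b)) (h b) := by
    intro b c hbc
    refine hq (funext fun t => ?_)
    simpa using DFunLike.congr_fun hbc (Ideal.Quotient.mk I (X t))
  have := ((linearIndependent_toLinearMap K (MvPolynomial τ K ⧸ I) K).comp _
    hinj).fintype_card_le_finrank
  rwa [Subspace.dual_finrank_eq] at this

end LeadingForms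

/-! ### The dimension of `A_X` is the number of bases -/

section DimAlgA

theorem finite_of_rank_le {K R : Type*} [Field K] [AddCommGroup R] [Module K R] {n : ℕ}
    (h : Module.rank K R ≤ n) : Module.Finite K R :=
  Module.rank_lt_aleph0_iff.1 (h.trans_lt Cardinal.natCast_lt_aleph0)

theorem finite_quotient_of_equiv {K R S : Type*} [Field K] [CommRing R] [Algebra K R] [CommRing S]
    [Algebra K S] (ψ : R ≃ₐ[K] S) {I : Ideal R} {J : Ideal S} (h : ∀ x ∈ I, ψ x ∈ J)
    [Module.Finite K (R ⧸ I)] :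
    Module.Finite K (S ⧸ J) ∧ Module.finrank K (S ⧸ J) ≤ Module.finrank K (R ⧸ I) := by
  let F : (R ⧸ I) →ₐ[K] S ⧸ J := Ideal.Quotient.liftₐ I ((Ideal.Quotient.mkₐ K J).comp ψ.toAlgHom)
    fun x hx => Ideal.Quotient.eq_zero_iff_mem.2 (h x hx)
  have hF : Function.Surjective F.toLinearMap := by
    intro y
    obtain ⟨y, rfl⟩ := Ideal.Quotient.mk_surjective y
    obtain ⟨x, rfl⟩ := ψ.surjective y
    exact ⟨Ideal.Quotient.mk I x, rfl⟩
  exact ⟨Module.Finite.of_surjective _ hF, LinearMap.finrank_le_finrank_of_surjective hF⟩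

/-- The point `p b` solves `x i = c i` for `i ∈ b` and depends linearly on `c`. For `i ∉ b` the
condition that it also lies on `x i = c i` is a proper hyperplane in the space of all `c`, and over
an infinite field some `c` avoids these finitely many hyperplanes. Then `p b` determines `b`. -/
theorem exists_generic_parameters {ι k W : Type*} [Finite ι] [Field k] [Infinite k]
    [AddCommGroup W] [Module k W] [FiniteDimensional k W] (x : ι → W) (S : Finset ι) :
    ∃ (c : ι → k) (p : Finset ι → Module.Dual k W),
      (∀ b ∈ basesIn k x S, ∀ i ∈ b, p b (x i) = c i) ∧
      Set.InjOn p (basesIn k x S : Set (Finset ι)) := by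
  classical
  have hB : ∀ b ∈ basesIn k x S, ∃ B : Module.Basis b k W, ∀ i, B i = x i := fun b hb => by
    have h := mem_basesIn.1 hb
    have hli : LinearIndependent k fun i : b => x i := h.2.1
    refine ⟨Module.Basis.mk hli ?_, fun i => by rw [Module.Basis.mk_apply]⟩
    rw [← h.2.2, Set.image_eq_range]
    rfl
  have hP : ∀ b, ∃ P : (ι → k) →ₗ[k] Module.Dual k W, b ∈ basesIn k x S →
      ∀ i ∈ b, ∀ c, P c (x i) = c i := fun b => by
    by_cases hb : b ∈ basesIn k x S
    · obtain ⟨B, hB⟩ := hB b hb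
      refine ⟨(B.constr k).toLinearMap ∘ₗ LinearMap.funLeft k k (fun i : b => (i : ι)),
        fun _ i hi c => ?_⟩
      rw [← hB ⟨i, hi⟩]
      simp [LinearMap.funLeft_apply]
    · exact ⟨0, fun h => (hb h).elim⟩
  choose P hP using hP
  let φ : {t : Finset ι × ι // t.1 ∈ basesIn k x S ∧ t.2 ∉ t.1} → Module.Dual k (ι → k) :=
    fun t => LinearMap.applyₗ (x t.1.2) ∘ₗ P t.1.1 - LinearMap.proj t.1.2
  have hφ : ∀ t, ∃ c, φ t c ≠ 0 := by
    rintro ⟨⟨b, i⟩, hb, hi⟩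
    obtain ⟨B, hB⟩ := hB b hb
    -- The point attached to `b` depends only on the coordinates of `c` in `b`, so for this `c` it
    -- is `0`, while `c i = 1`.
    refine ⟨Pi.single i 1, ?_⟩
    have h0 : P b (Pi.single i 1) = 0 := by
      refine B.ext fun j => ?_
      rw [hB, hP b hb j j.2]
      exact Pi.single_eq_of_ne (fun h : (j : ι) = i => hi (h ▸ j.2)) 1
    simp [φ, h0]
  obtain ⟨c, hc⟩ := Module.Dual.exists_forall_ne_zero_of_forall_exists φ hφ
  refine ⟨c, fun b => P b c, fun b hb i hi => hP b hb i hi c, fun b hb b' hb' hbb' => ?_⟩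
  have hcard : ∀ b ∈ basesIn k x S, b.card = Module.finrank k W := fun b hb => by
    obtain ⟨B, -⟩ := hB b hb
    rw [Module.finrank_eq_card_basis B, Fintype.card_coe]
  refine (Finset.eq_of_subset_of_card_le (fun i hi => ?_)
    ((hcard b hb).trans (hcard b' hb').symm).le).symm
  by_contra hib
  refine hc ⟨(b, i), hb, hib⟩ ?_
  have h1 : P b c (x i) = c i := by
    have : P b c = P b' c := hbb'
    rw [this, hP b' hb' i hi]
  simp [φ, h1]

variable {V : Type*} [NormedAddCommGroup V] [NormedSpace ℝ V] {Λ : Submodule ℤ V} {ι : Type*}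

variable (V) in
/-- The map `linElt`, as a semilinear map. -/
def linEltₛₗ : V →ₛₗ[algebraMap ℝ ℂ] SymC V where
  toFun := linElt
  map_add' v w := by simp [linElt, TensorProduct.tmul_add]
  map_smul' r v := by
    rw [linElt, linElt, ← map_smul, TensorProduct.tmul_smul, algebraMap_smul]

theorem adjoin_range_linElt : Algebra.adjoin ℂ (Set.range (linElt : V → SymC V)) = ⊤ := by
  refine Algebra.eq_top_iff.2 fun p => ?_
  induction p using SymmetricAlgebra.induction with
  | algebraMap r => exact Subalgebra.algebraMap_mem _ r
  | ι w =>
    induction w using TensorProduct.induction_on with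
    | zero => rw [map_zero]; exact zero_mem _
    | tmul c v =>
      have h : c ⊗ₜ[ℝ] v = c • ((1 : ℂ) ⊗ₜ[ℝ] v) := by simp [TensorProduct.smul_tmul']
      rw [h, map_smul]
      exact Subalgebra.smul_mem _ (Algebra.subset_adjoin (Set.mem_range_self v)) c
    | add w w' h h' => rw [map_add]; exact add_mem h h'
  | mul p q hp hq => exact mul_mem hp hq
  | add p q hp hq => exact add_mem hp hq

theorem rank_AlgA_le [Fintype ι] (X : ι → Λ) :
    Module.rank ℂ (AlgA X) ≤ (basesIn ℝ (fun i => (X i : V)) Finset.univ).card := by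
  refine rank_le_card_basesIn (σ := algebraMap ℝ ℂ) Finset.univ (fun i => (X i : V))
    ((Ideal.Quotient.mkₐ ℂ (idealI X)).toLinearMap.comp (linEltₛₗ V))
    (adjoin_range_mk_eq_top adjoin_range_linElt (idealI X)) fun Y _ hY => ?_
  have h : ∏ i ∈ Y, linElt (X i : V) ∈ idealI X := by
    refine Ideal.subset_span ⟨Y, ?_, rfl⟩
    rw [IsCocircuit]
    have hc : {i | i ∉ Y} = ((Finset.univ : Finset ι) : Set ι) \ Y := by ext i; simp
    rwa [hc]
  rw [← Ideal.Quotient.eq_zero_iff_mem, map_prod] at h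
  exact h

instance finite_AlgA [Finite ι] (X : ι → Λ) : Module.Finite ℂ (AlgA X) := by
  have := Fintype.ofFinite ι
  exact finite_of_rank_le (rank_AlgA_le X)

/-- The linear form of `v` in the coordinates given by the basis `e`. -/
def linForm {s : ℕ} (e : Module.Basis (Fin s) ℝ V) (v : V) : MvPolynomial (Fin s) ℂ :=
  ∑ j, MvPolynomial.C (e.repr v j : ℂ) * MvPolynomial.X j

theorem isHomogeneous_linForm {s : ℕ} (e : Module.Basis (Fin s) ℝ V) (v : V) :
    (linForm e v).IsHomogeneous 1 :=
  MvPolynomial.IsHomogeneous.sum _ _ _ fun j _ => MvPolynomial.isHomogeneous_C_mul_X _ j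

theorem aeval_linForm {s : ℕ} (e : Module.Basis (Fin s) ℝ V) (p : Module.Dual ℝ V) (v : V) :
    MvPolynomial.aeval (fun j => (p (e j) : ℂ)) (linForm e v) = p v := by
  have h : p v = ∑ j, e.repr v j * p (e j) := by
    conv_lhs => rw [← e.sum_repr v, map_sum]
    simp only [map_smul, smul_eq_mul]
  simp [linForm, h]

theorem equivMvPolynomial_linElt {s : ℕ} (e : Module.Basis (Fin s) ℝ V) (v : V) :
    SymmetricAlgebra.equivMvPolynomial (Algebra.TensorProduct.basis ℂ e) (linElt v) =
      linForm e v := by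
  have h : linElt v = ∑ j, (e.repr v j : ℂ) • SymmetricAlgebra.ι ℂ (ℂ ⊗[ℝ] V)
      (Algebra.TensorProduct.basis ℂ e j) := by
    conv_lhs => rw [← e.sum_repr v]
    change linEltₛₗ V _ = _
    rw [map_sum]
    refine Finset.sum_congr rfl fun j _ => ?_
    rw [LinearMap.map_smulₛₗ, Algebra.TensorProduct.basis_apply]
    rfl
  rw [h, map_sum, linForm]
  refine Finset.sum_congr rfl fun j _ => ?_
  rw [map_smul, SymmetricAlgebra.equivMvPolynomial_ι_apply, MvPolynomial.smul_eq_C_mul]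

theorem IsCocircuit.exists_mem {X : ι → Λ} {Y : Finset ι} (hY : IsCocircuit X Y) {b : Set ι}
    (hb : Submodule.span ℝ ((fun i => (X i : V)) '' b) = ⊤) : ∃ i ∈ Y, i ∈ b := by
  by_contra! h
  refine hY (eq_top_iff.2 (hb ▸ Submodule.span_mono (Set.image_mono fun i hi => ?_)))
  exact fun hiY => h i hiY hi

/-- Every cocircuit meets every basis `b`, so the products of the translated forms `a_i - c_i` all
vanish at `p b`. The deformed quotient therefore has at least as many dimensions as there are bases,
and its leading forms generate the ideal of `A_X`. -/
theorem card_basesIn_le [FiniteDimensional ℝ V] [Fintype ι] (X : ι → Λ) :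
    (basesIn ℝ (fun i => (X i : V)) Finset.univ).card ≤ Module.finrank ℂ (AlgA X) := by
  let e := Module.finBasis ℝ V
  obtain ⟨c, p, hp, hinj⟩ := exists_generic_parameters (k := ℝ) (fun i => (X i : V)) Finset.univ
  let g : {Y : Finset ι // IsCocircuit X Y} → MvPolynomial (Fin (Module.finrank ℝ V)) ℂ :=
    fun Y => ∏ i ∈ Y.1, linForm e (X i)
  let g' : {Y : Finset ι // IsCocircuit X Y} → MvPolynomial (Fin (Module.finrank ℝ V)) ℂ :=
    fun Y => ∏ i ∈ Y.1, (linForm e (X i) - MvPolynomial.C (c i : ℂ))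
  have h1 : ∀ x ∈ idealI X, SymmetricAlgebra.equivMvPolynomial (Algebra.TensorProduct.basis ℂ e) x ∈
      Ideal.span (Set.range g) := by
    intro x hx
    refine (Ideal.span_le (I := (Ideal.span (Set.range g)).comap (SymmetricAlgebra.equivMvPolynomial
      (Algebra.TensorProduct.basis ℂ e)))).2 ?_ hx
    rintro _ ⟨Y, hY, rfl⟩
    refine Ideal.mem_comap.2 (Ideal.subset_span ⟨⟨Y, hY⟩, ?_⟩)
    simp only [map_prod, equivMvPolynomial_linElt, g]
  obtain ⟨hfin, hle⟩ := finite_quotient_of_equiv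
    (SymmetricAlgebra.equivMvPolynomial (Algebra.TensorProduct.basis ℂ e)) h1
  obtain ⟨hfin', hle'⟩ := finite_quotient_of_leading (g := g) (g' := g') (d := fun Y => Y.1.card)
    (fun Y => by
      simpa using MvPolynomial.IsHomogeneous.prod Y.1 _ (fun _ => 1)
        fun i _ => isHomogeneous_linForm e (X i : V))
    (fun Y => prod_sub_C_sub_prod_mem_lowDegree (fun i => isHomogeneous_linForm e (X i : V))
      (fun i => (c i : ℂ)) Y.1)
  refine le_trans ?_ (hle'.trans hle)
  rw [← Fintype.card_coe]
  refine card_le_finrank_of_aeval_eq_zero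
    (q := fun b : basesIn ℝ (fun i => (X i : V)) Finset.univ => fun j => (p b (e j) : ℂ)) ?_ ?_
  · intro b b' hbb'
    refine Subtype.ext (hinj b.2 b'.2 (e.ext fun j => ?_))
    exact Complex.ofReal_injective (congrFun hbb' j)
  · intro b x hx
    refine (Ideal.span_le (I := RingHom.ker (MvPolynomial.aeval (R := ℂ)
      fun j => (p b (e j) : ℂ)))).2 ?_ hx
    rintro _ ⟨⟨Y, hY⟩, rfl⟩
    obtain ⟨i, hiY, hib⟩ := hY.exists_mem (mem_basesIn.1 b.2).2.2
    rw [SetLike.mem_coe, RingHom.mem_ker, map_prod]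
    refine Finset.prod_eq_zero hiY ?_
    rw [map_sub, aeval_linForm, hp b b.2 i hib, MvPolynomial.aeval_C]
    simp

theorem finrank_AlgA [FiniteDimensional ℝ V] [Fintype ι] (X : ι → Λ) :
    Module.finrank ℂ (AlgA X) = (basesIn ℝ (fun i => (X i : V)) Finset.univ).card :=
  le_antisymm (Module.finrank_le_of_rank_le (rank_AlgA_le X)) (card_basesIn_le X)

end DimAlgA

/-! ### Exponential and logarithm of nilpotent elements -/

section ExpLog

variable {R : Type*} [CommRing R] [Algebra ℂ R]

/-- The exponential of a nilpotent element of a `ℂ`-algebra. -/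
def nilExp (a : R) : R :=
  letI : Module ℚ R := Module.compHom R (algebraMap ℚ ℂ)
  IsNilpotent.exp a

theorem nilExp_eq_sum {a : R} {n : ℕ} (h : a ^ n = 0) :
    nilExp a = ∑ k ∈ Finset.range n, ((k.factorial : ℂ)⁻¹) • a ^ k := by
  let _ : Module ℚ R := Module.compHom R (algebraMap ℚ ℂ)
  refine (IsNilpotent.exp_eq_sum h).trans (Finset.sum_congr rfl fun k _ => ?_)
  change (algebraMap ℚ ℂ (k.factorial : ℚ)⁻¹) • a ^ k = _
  rw [map_inv₀, map_natCast]

theorem nilExp_add {a b : R} (ha : IsNilpotent a) (hb : IsNilpotent b) :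
    nilExp (a + b) = nilExp a * nilExp b := by
  let _ : Module ℚ R := Module.compHom R (algebraMap ℚ ℂ)
  exact IsNilpotent.exp_add_of_commute (Commute.all a b) ha hb

theorem nilExp_zero : nilExp (0 : R) = 1 := by
  let _ : Module ℚ R := Module.compHom R (algebraMap ℚ ℂ)
  exact IsNilpotent.exp_zero

theorem nilExp_mul_nilExp_neg {a : R} (ha : IsNilpotent a) : nilExp a * nilExp (-a) = 1 := by
  rw [← nilExp_add ha ha.neg, add_neg_cancel, nilExp_zero]

theorem map_nilExp {S : Type*} [CommRing S] [Algebra ℂ S] (f : R →ₐ[ℂ] S) {a : R}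
    (ha : IsNilpotent a) : f (nilExp a) = nilExp (f a) := by
  obtain ⟨n, hn⟩ := ha
  have hn' : f a ^ n = 0 := by rw [← map_pow, hn, map_zero]
  rw [nilExp_eq_sum hn, nilExp_eq_sum hn', map_sum]
  simp only [map_smul, map_pow]

/-- The nilpotency class may drop under a homomorphism; a free length `n` allows the sums in both
rings to be compared. -/
theorem logOneAdd_eq_sum {t : R} {n : ℕ} (h : t ^ n = 0) :
    logOneAdd t = ∑ k ∈ Finset.range n, ((-1 : ℂ) ^ k / ((k : ℂ) + 1)) • t ^ (k + 1) := by
  refine Finset.sum_subset (Finset.range_subset_range.2 (Nat.sInf_le h)) fun k _ hk => ?_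
  have h0 : t ^ nilpotencyClass t = 0 := pow_nilpotencyClass ⟨n, h⟩
  rw [Finset.mem_range, not_lt] at hk
  rw [pow_eq_zero_of_le (hk.trans k.le_succ) h0, smul_zero]

theorem map_logOneAdd {S : Type*} [CommRing S] [Algebra ℂ S] (f : R →ₐ[ℂ] S) {t : R}
    (ht : IsNilpotent t) : f (logOneAdd t) = logOneAdd (f t) := by
  obtain ⟨n, hn⟩ := ht
  have hn' : f t ^ n = 0 := by rw [← map_pow, hn, map_zero]
  rw [logOneAdd_eq_sum hn, logOneAdd_eq_sum hn', map_sum]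
  simp only [map_smul, map_pow]

/-- The sum is `t (1 + c 1 t + ⋯)`, and the second factor is `1` plus a nilpotent. So `exp a - 1`
and `log (1 + t)` generate the same ideals as `a` and `t`. -/
theorem exists_isUnit_sum_smul_pow_succ {t : R} (ht : IsNilpotent t) {c : ℕ → ℂ} (hc : c 0 = 1)
    {n : ℕ} (hn : 0 < n) :
    ∃ u : R, IsUnit u ∧ ∑ k ∈ Finset.range n, c k • t ^ (k + 1) = t * u := by
  obtain ⟨n, rfl⟩ := Nat.exists_eq_succ_of_ne_zero hn.ne'
  refine ⟨1 + t * ∑ k ∈ Finset.range n, c (k + 1) • t ^ k, ?_, ?_⟩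
  · exact (Commute.isNilpotent_mul_right (Commute.all _ _) ht).isUnit_one_add
  · rw [Finset.sum_range_succ', hc, mul_add, Finset.mul_sum, Finset.mul_sum, add_comm]
    congr 1
    · simp
    · refine Finset.sum_congr rfl fun k _ => ?_
      rw [mul_smul_comm, mul_smul_comm, pow_succ' _ (k + 1), pow_succ']

theorem exists_nilExp_eq {a : R} (ha : IsNilpotent a) : ∃ u : R, IsUnit u ∧ nilExp a = 1 + a * u := by
  obtain ⟨n, hn⟩ := ha
  obtain ⟨u, hu, h⟩ := exists_isUnit_sum_smul_pow_succ ⟨n, hn⟩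
    (c := fun k => ((k + 1).factorial : ℂ)⁻¹) (by simp) n.succ_pos
  refine ⟨u, hu, ?_⟩
  rw [nilExp_eq_sum (pow_eq_zero_of_le (n.le_add_right 2) hn), Finset.sum_range_succ', h]
  simp [add_comm]

theorem exists_logOneAdd_eq {t : R} (ht : IsNilpotent t) :
    ∃ u : R, IsUnit u ∧ logOneAdd t = t * u := by
  obtain ⟨n, hn⟩ := ht
  rw [logOneAdd_eq_sum (pow_eq_zero_of_le n.le_succ hn)]
  exact exists_isUnit_sum_smul_pow_succ ⟨n, hn⟩ (by simp) n.succ_pos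

theorem isNilpotent_nilExp_sub_one {a : R} (ha : IsNilpotent a) : IsNilpotent (nilExp a - 1) := by
  obtain ⟨u, -, h⟩ := exists_nilExp_eq ha
  rw [h, add_sub_cancel_left]
  exact Commute.isNilpotent_mul_right (Commute.all _ _) ha

theorem isNilpotent_logOneAdd {t : R} (ht : IsNilpotent t) : IsNilpotent (logOneAdd t) := by
  obtain ⟨u, -, h⟩ := exists_logOneAdd_eq ht
  rw [h]
  exact Commute.isNilpotent_mul_right (Commute.all _ _) ht

/-- From `1 = exp (a - b) = 1 + (a - b) u` with `u` a unit it follows that `a - b = 0`. -/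
theorem nilExp_inj {a b : R} (ha : IsNilpotent a) (hb : IsNilpotent b) (h : nilExp a = nilExp b) :
    a = b := by
  have hab : IsNilpotent (a - b) := Commute.isNilpotent_sub (Commute.all _ _) ha hb
  obtain ⟨u, hu, hu'⟩ := exists_nilExp_eq hab
  have h1 : nilExp (a - b) = 1 := by
    rw [sub_eq_add_neg, nilExp_add ha hb.neg, h, nilExp_mul_nilExp_neg hb]
  rw [h1, left_eq_add, hu.mul_left_eq_zero] at hu'
  exact sub_eq_zero.1 hu'

open Polynomial in
theorem derivative_nilExp {p : R[X]} (hp : IsNilpotent p) :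
    derivative (nilExp p) = nilExp p * derivative p := by
  obtain ⟨n, hn⟩ := hp
  conv_lhs => rw [nilExp_eq_sum (pow_eq_zero_of_le n.le_succ hn), Finset.sum_range_succ']
  rw [nilExp_eq_sum hn, derivative_add, derivative_sum, Finset.sum_mul]
  simp only [derivative_smul, pow_zero, derivative_one, smul_zero, add_zero]
  refine Finset.sum_congr rfl fun k _ => ?_
  rw [derivative_pow, Nat.add_sub_cancel, smul_mul_assoc, mul_assoc]
  rw [← smul_eq_C_mul, Nat.cast_smul_eq_nsmul, ← Nat.cast_smul_eq_nsmul ℂ, smul_smul,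
    Nat.factorial_succ]
  congr 1
  have h1 : ((k + 1 : ℕ) : ℂ) ≠ 0 := Nat.cast_ne_zero.2 k.succ_ne_zero
  push_cast at h1 ⊢
  field_simp

open Polynomial in
theorem eval_eq_eval_of_derivative_eq_zero {p : R[X]} (hp : derivative p = 0) (a b : R) :
    p.eval a = p.eval b := by
  have h : p = C (p.coeff 0) := by
    ext n
    cases n with
    | zero => simp
    | succ n =>
      have h1 : p.coeff (n + 1) * ((n : R) + 1) = 0 := by rw [← coeff_derivative, hp, coeff_zero]
      have h2 : IsUnit ((n : R) + 1) := by
        have := (IsUnit.mk0 ((n : ℂ) + 1) (Nat.cast_add_one_ne_zero n)).map (algebraMap ℂ R)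
        simpa using this
      rw [h2.mul_left_eq_zero.1 h1, coeff_C_succ]
  rw [h, eval_C, eval_C]

-- Set `u = tX` in `R[X]`. The derivative of `log (1 + u)` is a finite geometric series, equal to `t
-- / (1 + u)`, so `exp (-log (1 + u)) (1 + u)` has derivative zero. Its values at `X = 1` and `X =
-- 0` therefore agree, and the latter is `1`.
open Polynomial in
theorem nilExp_logOneAdd {t : R} (ht : IsNilpotent t) : nilExp (logOneAdd t) = 1 + t := by
  obtain ⟨n, hn⟩ := ht
  set u : R[X] := C t * X with hu
  have hun : u ^ n = 0 := by rw [hu, mul_pow, ← C_pow, hn, C_0, zero_mul]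
  have hlog : IsNilpotent (logOneAdd u) := isNilpotent_logOneAdd ⟨n, hun⟩
  have hdu : derivative u = C t := by simp [hu]
  have hdlog : derivative (logOneAdd u) * (1 + u) = C t := by
    have h1 : derivative (logOneAdd u) = C t * ∑ k ∈ Finset.range n, (-u) ^ k := by
      rw [logOneAdd_eq_sum hun, derivative_sum, Finset.mul_sum]
      refine Finset.sum_congr rfl fun k _ => ?_
      have h2 : ((k + 1 : ℕ) : ℂ) ≠ 0 := Nat.cast_ne_zero.2 k.succ_ne_zero
      rw [derivative_smul, derivative_pow, Nat.add_sub_cancel, hdu, mul_assoc, ← smul_eq_C_mul,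
        Nat.cast_smul_eq_nsmul, ← Nat.cast_smul_eq_nsmul ℂ, smul_smul]
      push_cast at h2 ⊢
      rw [div_mul_cancel₀ _ h2, neg_pow u, mul_comm (C t)]
      rw [Algebra.smul_def, map_pow, map_neg, map_one, mul_assoc]
    have h3 := geom_sum_mul (-u) n
    rw [neg_pow, hun, mul_zero, zero_sub] at h3
    rw [h1, mul_assoc, show 1 + u = -(-u - 1) by ring, mul_neg, h3, neg_neg, mul_one]
  have hd : derivative (nilExp (-logOneAdd u) * (1 + u)) = 0 := by
    rw [derivative_mul, derivative_nilExp hlog.neg, derivative_neg, derivative_add, derivative_one,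
      zero_add, hdu]
    linear_combination (-nilExp (-logOneAdd u)) * hdlog
  have hev : ∀ a : R, (nilExp (-logOneAdd u) * (1 + u)).eval a =
      nilExp (-logOneAdd (t * a)) * (1 + t * a) := by
    intro a
    have h4 : ((aeval a).restrictScalars ℂ) u = t * a := by simp [hu]
    have h5 := map_nilExp ((aeval (R := R) a).restrictScalars ℂ) hlog.neg
    rw [map_neg, map_logOneAdd _ ⟨n, hun⟩, h4] at h5
    rw [← h5]
    simp [hu, coe_aeval_eq_eval]
  have h := eval_eq_eval_of_derivative_eq_zero hd 1 0
  have h0 : logOneAdd (0 : R) = 0 := by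
    rw [logOneAdd_eq_sum (n := 1) (by simp)]; simp
  rw [hev, hev, mul_one, mul_zero, h0, neg_zero, nilExp_zero, add_zero, mul_one] at h
  have hl := isNilpotent_logOneAdd (t := t) ⟨n, hn⟩
  calc nilExp (logOneAdd t) = nilExp (logOneAdd t) * (nilExp (-logOneAdd t) * (1 + t)) := by
        rw [h, mul_one]
    _ = 1 + t := by rw [← mul_assoc, nilExp_mul_nilExp_neg hl, one_mul]

theorem logOneAdd_add {s t r : R} (hs : IsNilpotent s) (ht : IsNilpotent t) (hr : IsNilpotent r)
    (h : 1 + r = (1 + s) * (1 + t)) : logOneAdd r = logOneAdd s + logOneAdd t := by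
  have hs' := isNilpotent_logOneAdd hs
  have ht' := isNilpotent_logOneAdd ht
  refine nilExp_inj (isNilpotent_logOneAdd hr)
    (Commute.isNilpotent_add (Commute.all _ _) hs' ht') ?_
  rw [nilExp_add hs' ht', nilExp_logOneAdd hs, nilExp_logOneAdd ht, nilExp_logOneAdd hr, h]

end ExpLog

/-! ### Sublattices spanned by bases, and the characters trivial on them -/

section SubLattice

variable {V : Type*} [NormedAddCommGroup V] {Λ : Submodule ℤ V} {ι : Type*}

/-- The lattice generated by the sublist `b`. -/
def subLattice (X : ι → Λ) (b : Finset ι) : Submodule ℤ Λ :=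
  Submodule.span ℤ (Set.range fun i : b => X i)

/-- The characters that are trivial on the sublist `b`. -/
def trivialOn (X : ι → Λ) (b : Finset ι) : Set (AddChar Λ ℂ) := {χ | ∀ i ∈ b, χ (X i) = 1}

theorem range_compAddMonoidHom_mk (X : ι → Λ) (b : Finset ι) :
    Set.range (fun ψ : AddChar (Λ ⧸ (subLattice X b).toAddSubgroup) ℂ =>
      ψ.compAddMonoidHom (QuotientAddGroup.mk' (subLattice X b).toAddSubgroup)) =
      trivialOn X b := by
  ext χ
  constructor
  · rintro ⟨ψ, rfl⟩ i hi
    have h : (QuotientAddGroup.mk' (subLattice X b).toAddSubgroup) (X i) = 0 :=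
      (QuotientAddGroup.eq_zero_iff _).2 (Submodule.subset_span ⟨⟨i, hi⟩, rfl⟩)
    simp only [AddChar.compAddMonoidHom_apply, h, AddChar.map_zero_eq_one]
  · intro hχ
    have h : (subLattice X b).toAddSubgroup ≤ (AddChar.toAddMonoidHom χ).ker := by
      rw [subLattice, Submodule.span_int_eq_addSubgroupClosure, AddSubgroup.closure_le]
      rintro _ ⟨i, rfl⟩
      exact hχ i i.2
    refine ⟨AddChar.toAddMonoidHomEquiv.symm (QuotientAddGroup.lift _ χ.toAddMonoidHom h), ?_⟩
    ext x
    rfl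

variable [NormedSpace ℝ V]

theorem IsExtractedBasis.linearIndependent_int {X : ι → Λ} {b : Finset ι}
    (hb : IsExtractedBasis X b) : LinearIndependent ℤ fun i : b => X i := by
  have h : LinearIndependent ℤ fun i : b => (X i : V) := hb.1.restrict_scalars' ℤ
  exact LinearIndependent.of_comp Λ.subtype h

theorem IsExtractedBasis.card_eq_finrank {X : ι → Λ} {b : Finset ι} (hb : IsExtractedBasis X b) :
    b.card = Module.finrank ℝ V := by
  have h : ⊤ ≤ Submodule.span ℝ (Set.range fun i : b => (X i : V)) := by
    rw [← hb.2, Set.image_eq_range]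
    rfl
  rw [Module.finrank_eq_card_basis (Module.Basis.mk hb.1 h), Fintype.card_coe]

theorem mem_basesIn_univ_iff [Fintype ι] {X : ι → Λ} {b : Finset ι} :
    b ∈ basesIn ℝ (fun i => (X i : V)) Finset.univ ↔ IsExtractedBasis X b := by
  rw [mem_basesIn]
  exact and_iff_right (Finset.subset_univ b)

theorem exists_isExtractedBasis [Finite ι] {X : ι → Λ} {t : Set ι}
    (ht : Submodule.span ℝ ((fun i => (X i : V)) '' t) = ⊤) :
    ∃ b : Finset ι, IsExtractedBasis X b ∧ ∀ i ∈ b, i ∈ t := by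
  obtain ⟨b, hbt, -, hsp, hli⟩ := exists_linearIndepOn_extension
    (K := ℝ) (v := fun i => (X i : V)) (linearIndepOn_empty ℝ _) (Set.empty_subset t)
  have hfin : b.Finite := Set.toFinite b
  refine ⟨hfin.toFinset, ⟨?_, ?_⟩, fun i hi => hbt (hfin.mem_toFinset.1 hi)⟩
  · have h : LinearIndepOn ℝ (fun i => (X i : V)) (hfin.toFinset : Set ι) := by
      rwa [hfin.coe_toFinset]
    exact h
  · rw [hfin.coe_toFinset, eq_top_iff, ← ht]
    exact Submodule.span_le.2 hsp

variable [FiniteDimensional ℝ V] [DiscreteTopology Λ] [IsZLattice ℝ Λ]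

theorem finite_quotient_subLattice {X : ι → Λ} {b : Finset ι} (hb : IsExtractedBasis X b) :
    Finite (Λ ⧸ (subLattice X b).toAddSubgroup) := by
  have : Module.Free ℤ Λ := ZLattice.module_free ℝ Λ
  have : Module.Finite ℤ Λ := ZLattice.module_finite ℝ Λ
  refine Submodule.finiteQuotientOfFreeOfRankEq (subLattice X b) ?_
  rw [subLattice, finrank_span_eq_card hb.linearIndependent_int, ZLattice.rank ℝ Λ,
    Fintype.card_coe, hb.card_eq_finrank]

theorem absDet_eq_card_quotient {s N : ℕ} (e : Module.Basis (Fin s) ℤ Λ) {X : Fin N → Λ}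
    {b : Finset (Fin N)} (hb : IsExtractedBasis X b) :
    absDet e X b = Nat.card (Λ ⧸ (subLattice X b).toAddSubgroup) := by
  have : Module.Free ℤ Λ := ZLattice.module_free ℝ Λ
  have : Module.Finite ℤ Λ := ZLattice.module_finite ℝ Λ
  have h : b.card = s := by
    rw [hb.card_eq_finrank, ← ZLattice.rank ℝ Λ, Module.finrank_eq_card_basis e, Fintype.card_fin]
  let B : Module.Basis (Fin s) ℤ (subLattice X b) := (Module.Basis.span hb.linearIndependent_int).reindex (b.orderIsoOfFin h).toEquiv.symm
  have hB := Submodule.natAbs_det_basis_change e (subLattice X b) B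
  rw [absDet, dif_pos h, ← Module.Basis.det_apply]
  refine Eq.trans ?_ hB
  congr 2
  funext j
  have hBj : B j = Module.Basis.span hb.linearIndependent_int (b.orderIsoOfFin h j) :=
    Module.Basis.reindex_apply (Module.Basis.span hb.linearIndependent_int) _ j
  rw [Function.comp_apply, hBj, Module.Basis.span_apply]
  rfl

/-- These characters form the dual of the finite group `Λ/⟨b⟩`, which has the same order as the
group. -/
theorem card_trivialOn {X : ι → Λ} {b : Finset ι} (hb : IsExtractedBasis X b) :
    (trivialOn X b).Finite ∧
      Nat.card (trivialOn X b) = Nat.card (Λ ⧸ (subLattice X b).toAddSubgroup) := by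
  have := finite_quotient_subLattice hb
  have := Fintype.ofFinite (Λ ⧸ (subLattice X b).toAddSubgroup)
  have hinj : Function.Injective
      (fun ψ : AddChar (Λ ⧸ (subLattice X b).toAddSubgroup) ℂ =>
        ψ.compAddMonoidHom (QuotientAddGroup.mk' (subLattice X b).toAddSubgroup)) := by
    intro ψ ψ' h
    ext x
    obtain ⟨x, rfl⟩ := QuotientAddGroup.mk'_surjective _ x
    exact DFunLike.congr_fun h x
  rw [← range_compAddMonoidHom_mk]
  refine ⟨Set.finite_range _, ?_⟩
  rw [Nat.card_range_of_injective hinj, Nat.card_eq_fintype_card, Nat.card_eq_fintype_card,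
    AddChar.card_eq]

theorem finite_points [Finite ι] (X : ι → Λ) : (points X).Finite := by
  have h : points X = ⋃ b ∈ {b : Finset ι | IsExtractedBasis X b}, trivialOn X b := by
    ext χ
    simp [points, trivialOn]
  rw [h]
  exact (Set.toFinite _).biUnion fun b hb => (card_trivialOn hb).1

/-- The product of all indices `[Λ : ⟨b⟩]` works. A common `m` is needed because the basis found
below varies with the prime. -/
theorem exists_pos_nsmul_mem [Finite ι] (X : ι → Λ) :
    ∃ m : ℕ, 0 < m ∧ ∀ b, IsExtractedBasis X b → ∀ a : Λ, m • a ∈ subLattice X b := by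
  classical
  have := Fintype.ofFinite ι
  refine ⟨∏ b with IsExtractedBasis X b, Nat.card (Λ ⧸ (subLattice X b).toAddSubgroup),
    Finset.prod_pos fun b hb => ?_, fun b hb a => ?_⟩
  · have := finite_quotient_subLattice (Finset.mem_filter.1 hb).2
    exact Nat.card_pos
  · obtain ⟨d, hd⟩ := Finset.dvd_prod_of_mem
      (fun b => Nat.card (Λ ⧸ (subLattice X b).toAddSubgroup))
      (Finset.mem_filter.2 ⟨Finset.mem_univ b, hb⟩)
    rw [hd, mul_comm, mul_smul]
    refine Submodule.smul_of_tower_mem _ d ?_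
    have h : (Nat.card (Λ ⧸ (subLattice X b).toAddSubgroup)) •
      (a : Λ ⧸ (subLattice X b).toAddSubgroup) = 0 := card_nsmul_eq_zero'
    exact (QuotientAddGroup.eq_zero_iff _).1 h

end SubLattice

/-! ### The primes containing `J_X` -/

section Points

variable {V : Type*} [NormedAddCommGroup V] {Λ : Submodule ℤ V} {ι : Type*}

theorem expElt_zero : expElt (0 : Λ) = 1 := rfl

theorem expElt_add (a b : Λ) : expElt (a + b) = expElt a * expElt b := by
  simp [expElt, AddMonoidAlgebra.single_mul_single]

theorem expElt_neg_mul (a : Λ) : expElt (-a) * expElt a = 1 := by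
  rw [← expElt_add, neg_add_cancel, expElt_zero]

theorem expElt_nsmul (m : ℕ) (a : Λ) : expElt (m • a) = expElt a ^ m := by
  induction m with
  | zero => rw [zero_smul, pow_zero, expElt_zero]
  | succ m ih => rw [succ_nsmul, expElt_add, ih, pow_succ]

@[simp]
theorem evalAt_expElt (χ : AddChar Λ ℂ) (a : Λ) : evalAt χ (expElt a) = χ a := by
  simp [evalAt, expElt]

theorem evalAt_surjective (χ : AddChar Λ ℂ) : Function.Surjective (evalAt χ) := fun c =>
  ⟨algebraMap ℂ _ c, by rw [AlgHom.commutes]; rfl⟩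

instance pointIdeal_isMaximal (χ : AddChar Λ ℂ) : (pointIdeal χ).IsMaximal :=
  RingHom.ker_isMaximal_of_surjective (evalAt χ) (evalAt_surjective χ)

theorem mem_pointIdeal {χ : AddChar Λ ℂ} {f : AddMonoidAlgebra ℂ Λ} :
    f ∈ pointIdeal χ ↔ evalAt χ f = 0 := Iff.rfl

theorem addChar_ne_zero (χ : AddChar Λ ℂ) (a : Λ) : χ a ≠ 0 := fun h => by
  have h1 := χ.map_add_eq_mul a (-a)
  rw [add_neg_cancel, χ.map_zero_eq_one, h, zero_mul] at h1
  exact one_ne_zero h1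

theorem addChar_neg (χ : AddChar Λ ℂ) (a : Λ) : χ (-a) = (χ a)⁻¹ := by
  have h1 := χ.map_add_eq_mul a (-a)
  rw [add_neg_cancel, χ.map_zero_eq_one] at h1
  exact eq_inv_of_mul_eq_one_right h1.symm

/-- Every algebra map from the group algebra to `ℂ` is evaluation at a character. -/
theorem exists_evalAt_eq (φ : AddMonoidAlgebra ℂ Λ →ₐ[ℂ] ℂ) : ∃ χ : AddChar Λ ℂ, evalAt χ = φ :=
  ⟨AddChar.toMonoidHomEquiv.symm ((AddMonoidAlgebra.lift ℂ ℂ Λ).symm φ),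
    (AddMonoidAlgebra.lift ℂ ℂ Λ).apply_symm_apply φ⟩

/-- The elements `a` of the lattice with `e^a = 1` modulo `P`. -/
def trivialSubgroup (P : Ideal (AddMonoidAlgebra ℂ Λ)) : AddSubgroup Λ where
  carrier := {a | expElt a - 1 ∈ P}
  add_mem' {a b} ha hb := by
    have h := P.add_mem (P.mul_mem_left (expElt a) hb) ha
    rw [Set.mem_ofPred_eq, expElt_add]
    convert h using 1
    ring
  zero_mem' := by simp [expElt_zero]
  neg_mem' {a} ha := by
    have h := P.mul_mem_left (-expElt (-a)) ha
    rw [Set.mem_ofPred_eq]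
    convert h using 1
    linear_combination expElt_neg_mul a

theorem mem_trivialSubgroup {P : Ideal (AddMonoidAlgebra ℂ Λ)} {a : Λ} :
    a ∈ trivialSubgroup P ↔ expElt a - 1 ∈ P := Iff.rfl

theorem one_sub_expElt_neg_mem {P : Ideal (AddMonoidAlgebra ℂ Λ)} {a : Λ} :
    1 - expElt (-a) ∈ P ↔ a ∈ trivialSubgroup P := by
  rw [← neg_mem_iff (x := a), mem_trivialSubgroup, ← neg_mem_iff, neg_sub]

theorem subLattice_le_trivialSubgroup {X : ι → Λ} {b : Finset ι}
    {P : Ideal (AddMonoidAlgebra ℂ Λ)} (h : ∀ i ∈ b, X i ∈ trivialSubgroup P) :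
    (subLattice X b).toAddSubgroup ≤ trivialSubgroup P := by
  rw [subLattice, Submodule.span_int_eq_addSubgroupClosure, AddSubgroup.closure_le]
  rintro _ ⟨i, rfl⟩
  exact h i i.2

variable [NormedSpace ℝ V]

/-- If the vectors with `e^a = 1` modulo `P` did not span, the remaining ones would form a
cocircuit. Its product lies in the prime `P`, so one factor does, a contradiction. -/
theorem exists_basis_mem_trivialSubgroup [Finite ι] {X : ι → Λ}
    {P : Ideal (AddMonoidAlgebra ℂ Λ)} [hP : P.IsPrime] (hJ : idealJ X ≤ P) :
    ∃ b, IsExtractedBasis X b ∧ ∀ i ∈ b, X i ∈ trivialSubgroup P := by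
  refine exists_isExtractedBasis (t := {i | X i ∈ trivialSubgroup P}) ?_
  by_contra h
  have hfin : {i | X i ∉ trivialSubgroup P}.Finite := Set.toFinite _
  have hY : IsCocircuit X hfin.toFinset := by
    rw [IsCocircuit]
    convert h using 4
    ext i
    simp
  have h1 : ∏ i ∈ hfin.toFinset, (1 - expElt (-X i)) ∈ P :=
    hJ (Ideal.subset_span ⟨_, hY, rfl⟩)
  obtain ⟨i, hi, hiP⟩ := hP.prod_mem_iff.1 h1
  exact (hfin.mem_toFinset.1 hi) (one_sub_expElt_neg_mem.1 hiP)

variable [FiniteDimensional ℝ V] [DiscreteTopology Λ] [IsZLattice ℝ Λ] [Finite ι]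

/-- The element `(e^a)^m - 1` lies in every prime of the quotient, so it is nilpotent and `(T^m -
1)^n` is a monic equation for `e^a`. -/
theorem isIntegral_mk_expElt (X : ι → Λ) (a : Λ) :
    IsIntegral ℂ (Ideal.Quotient.mk (idealJ X) (expElt a)) := by
  obtain ⟨m, hm, hmb⟩ := exists_pos_nsmul_mem X
  have hnil : IsNilpotent (Ideal.Quotient.mk (idealJ X) (expElt a) ^ m - 1) := by
    rw [nilpotent_iff_mem_prime]
    intro P hP
    have hP' : (P.comap (Ideal.Quotient.mk (idealJ X))).IsPrime := Ideal.comap_isPrime _ _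
    have hJ : idealJ X ≤ P.comap (Ideal.Quotient.mk (idealJ X)) := fun f hf => by
      rw [Ideal.mem_comap, Ideal.Quotient.eq_zero_iff_mem.2 hf]
      exact zero_mem P
    obtain ⟨b, hb, hbP⟩ := exists_basis_mem_trivialSubgroup hJ
    have h := subLattice_le_trivialSubgroup hbP (hmb b hb a)
    rw [mem_trivialSubgroup, expElt_nsmul, Ideal.mem_comap, map_sub, map_pow, map_one] at h
    exact h
  obtain ⟨n, hn⟩ := hnil
  refine ⟨(Polynomial.X ^ m - 1) ^ n, (Polynomial.monic_X_pow_sub_C 1 hm.ne').pow n, ?_⟩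
  simp [hn]

theorem isIntegral_quotJ (X : ι → Λ) : Algebra.IsIntegral ℂ (QuotJ X) := by
  refine ⟨fun x => ?_⟩
  obtain ⟨f, rfl⟩ := Ideal.Quotient.mk_surjective x
  induction f using AddMonoidAlgebra.induction_linear with
  | zero => rw [map_zero]; exact isIntegral_zero
  | add f g hf hg => rw [map_add]; exact hf.add hg
  | single a c =>
    have h : (AddMonoidAlgebra.single a c : AddMonoidAlgebra ℂ Λ) = c • expElt a := by
      simp [expElt]
    rw [h]
    exact (isIntegral_mk_expElt X a).smul c

theorem finite_quotJ (X : ι → Λ) : Module.Finite ℂ (QuotJ X) := by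
  have := isIntegral_quotJ X
  have : Module.Finite ℤ Λ := ZLattice.module_finite ℝ Λ
  have : AddMonoid.FG Λ := AddGroup.fg_iff_addMonoid_fg.1 (Module.Finite.iff_addGroup_fg.1 this)
  exact Algebra.IsIntegral.finite

/-- The quotient by `P` is a domain integral over `ℂ`, hence equal to `ℂ`, so `P` is the kernel of
an evaluation. -/
theorem exists_eq_pointIdeal {X : ι → Λ} (P : Ideal (AddMonoidAlgebra ℂ Λ)) [P.IsPrime]
    (hJ : idealJ X ≤ P) : ∃ χ ∈ points X, P = pointIdeal χ := by
  have := isIntegral_quotJ X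
  have hint : Algebra.IsIntegral ℂ (AddMonoidAlgebra ℂ Λ ⧸ P) :=
    Algebra.IsIntegral.of_surjective (Ideal.Quotient.factorₐ ℂ hJ)
      (Ideal.Quotient.factor_surjective hJ)
  let ψ := AlgEquiv.ofBijective (Algebra.ofId ℂ (AddMonoidAlgebra ℂ Λ ⧸ P))
    IsAlgClosed.algebraMap_bijective_of_isIntegral
  obtain ⟨χ, hχ⟩ := exists_evalAt_eq (ψ.symm.toAlgHom.comp (Ideal.Quotient.mkₐ ℂ P))
  have hP : P = pointIdeal χ := by
    ext f
    rw [mem_pointIdeal, hχ, ← Ideal.Quotient.eq_zero_iff_mem]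
    exact (EmbeddingLike.map_eq_zero_iff (f := ψ.symm)).symm
  obtain ⟨b, hb, hbP⟩ := exists_basis_mem_trivialSubgroup hJ
  refine ⟨χ, ⟨b, hb, fun i hi => ?_⟩, hP⟩
  have h := hbP i hi
  rw [mem_trivialSubgroup, hP, mem_pointIdeal, map_sub, map_one, evalAt_expElt] at h
  exact sub_eq_zero.1 h

end Points

/-! ### Splitting `ℂ[Λ]/J_X` into its localizations -/

section Decomposition

variable {V : Type*} [NormedAddCommGroup V] [NormedSpace ℝ V] {Λ : Submodule ℤ V} {ι : Type*}

/-- The map from the group algebra to the localization of `ℂ[Λ]/J_X` at `χ`. -/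
def toLoc (X : ι → Λ) (χ : AddChar Λ ℂ) : AddMonoidAlgebra ℂ Λ →ₐ[ℂ] LocQuotJ X χ :=
  (Algebra.algHom ℂ (QuotJ X) (LocQuotJ X χ)).comp (Ideal.Quotient.mkₐ ℂ (idealJ X))

theorem toLoc_apply (X : ι → Λ) (χ : AddChar Λ ℂ) (f : AddMonoidAlgebra ℂ Λ) :
    toLoc X χ f = algebraMap (QuotJ X) (LocQuotJ X χ) (Ideal.Quotient.mk (idealJ X) f) := rfl

theorem isUnit_toLoc (X : ι → Λ) {χ : AddChar Λ ℂ} {f : AddMonoidAlgebra ℂ Λ}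
    (hf : evalAt χ f ≠ 0) : IsUnit (toLoc X χ f) :=
  IsLocalization.map_units (LocQuotJ X χ)
    (⟨_, Submonoid.mem_map_of_mem _ hf⟩ :
      (pointIdeal χ).primeCompl.map (Ideal.Quotient.mk (idealJ X)))

theorem toLoc_eq_zero (X : ι → Λ) (χ : AddChar Λ ℂ) {f : AddMonoidAlgebra ℂ Λ}
    (hf : f ∈ idealJ X) : toLoc X χ f = 0 := by
  rw [toLoc_apply, Ideal.Quotient.eq_zero_iff_mem.2 hf, map_zero]

theorem unipotentPart_eq (X : ι → Λ) (χ : AddChar Λ ℂ) (a : Λ) :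
    unipotentPart X χ a = toLoc X χ ((χ a)⁻¹ • expElt a - 1) := rfl

theorem one_add_unipotentPart (X : ι → Λ) (χ : AddChar Λ ℂ) (a : Λ) :
    1 + unipotentPart X χ a = (χ a)⁻¹ • toLoc X χ (expElt a) := by
  rw [unipotentPart_eq, map_sub, map_smul, map_one, add_sub_cancel]

theorem exists_toLoc_eq_mul (X : ι → Λ) (χ : AddChar Λ ℂ) (x : LocQuotJ X χ) :
    ∃ f g : AddMonoidAlgebra ℂ Λ, evalAt χ g ≠ 0 ∧ x * toLoc X χ g = toLoc X χ f := by
  obtain ⟨⟨f, ⟨_, g, hg, rfl⟩⟩, h⟩ := IsLocalization.surj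
    ((pointIdeal χ).primeCompl.map (Ideal.Quotient.mk (idealJ X))) x
  obtain ⟨f, rfl⟩ := Ideal.Quotient.mk_surjective f
  exact ⟨f, g, hg, h⟩

theorem idealJ_le_comap (X : ι → Λ) (P : Ideal (QuotJ X)) :
    idealJ X ≤ P.comap (Ideal.Quotient.mk (idealJ X)) := fun f hf => by
  rw [Ideal.mem_comap, Ideal.Quotient.eq_zero_iff_mem.2 hf]
  exact zero_mem P

variable [FiniteDimensional ℝ V] [DiscreteTopology Λ] [IsZLattice ℝ Λ] [Finite ι]

/-- A prime of the localization pulls back to a maximal ideal inside that of `χ`, hence to that of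
`χ`, which contains `χ(a)⁻¹ e^a - 1`. -/
theorem isNilpotent_unipotentPart (X : ι → Λ) (χ : AddChar Λ ℂ) (a : Λ) :
    IsNilpotent (unipotentPart X χ a) := by
  rw [nilpotent_iff_mem_prime]
  intro q hq
  have hP : (q.comap (toLoc X χ)).IsPrime := Ideal.comap_isPrime _ _
  obtain ⟨χ', -, hχ'⟩ := exists_eq_pointIdeal (X := X) (q.comap (toLoc X χ)) fun f hf => by
    rw [Ideal.mem_comap, toLoc_eq_zero X χ hf]
    exact zero_mem q
  have hle : q.comap (toLoc X χ) ≤ pointIdeal χ := fun f hf => by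
    by_contra h
    exact hq.ne_top (Ideal.eq_top_of_isUnit_mem q hf (isUnit_toLoc X h))
  have heq : q.comap (toLoc X χ) = pointIdeal χ := by
    rw [hχ'] at hle ⊢
    exact Ideal.IsMaximal.eq_of_le inferInstance (Ideal.IsPrime.ne_top inferInstance) hle
  have hmem : (χ a)⁻¹ • expElt a - 1 ∈ q.comap (toLoc X χ) := by
    rw [heq, mem_pointIdeal, map_sub, map_smul, map_one, evalAt_expElt, smul_eq_mul,
      inv_mul_cancel₀ (addChar_ne_zero χ a), sub_self]
  exact hmem

theorem exists_comap_eq_pointIdeal {X : ι → Λ} (P : Ideal (QuotJ X)) [P.IsPrime] :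
    ∃ χ ∈ points X, P.comap (Ideal.Quotient.mk (idealJ X)) = pointIdeal χ :=
  have : (P.comap (Ideal.Quotient.mk (idealJ X))).IsPrime := Ideal.comap_isPrime _ _
  exists_eq_pointIdeal _ (idealJ_le_comap X P)

theorem eq_zero_of_forall_algebraMap_eq_zero {X : ι → Λ} {x : QuotJ X}
    (hx : ∀ χ ∈ points X, algebraMap (QuotJ X) (LocQuotJ X χ) x = 0) : x = 0 := by
  by_contra hne
  have hann : Ideal.torsionOf (QuotJ X) (QuotJ X) x ≠ ⊤ := fun h => by
    have h1 : (1 : QuotJ X) ∈ Ideal.torsionOf (QuotJ X) (QuotJ X) x := h ▸ Submodule.mem_top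
    rw [Ideal.mem_torsionOf_iff, one_smul] at h1
    exact hne h1
  obtain ⟨P, hP, hle⟩ := Ideal.exists_le_maximal _ hann
  have := hP.isPrime
  obtain ⟨χ, hχ, hPχ⟩ := exists_comap_eq_pointIdeal P
  obtain ⟨⟨_, g, hg, rfl⟩, h⟩ := (IsLocalization.map_eq_zero_iff
    ((pointIdeal χ).primeCompl.map (Ideal.Quotient.mk (idealJ X))) (LocQuotJ X χ) x).1 (hx χ hχ)
  refine hg (?_ : g ∈ pointIdeal χ)
  rw [← hPχ]
  exact hle ((Ideal.mem_torsionOf_iff x _).2 h)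

theorem algebraMap_locQuotJ_surjective (X : ι → Λ) (χ : AddChar Λ ℂ) :
    Function.Surjective (algebraMap (QuotJ X) (LocQuotJ X χ)) := by
  have := finite_quotJ X
  have : IsArtinianRing (QuotJ X) := IsArtinianRing.of_finite ℂ (QuotJ X)
  exact IsArtinianRing.localization_surjective
    ((pointIdeal χ).primeCompl.map (Ideal.Quotient.mk (idealJ X))) (LocQuotJ X χ)

/-- Some power of each `χ(a)⁻¹ e^a - 1` dies in the localization, so `P` contains it, and evaluation
at `χ'` gives `χ'(a) = χ(a)`. -/
theorem eq_of_ker_le {X : ι → Λ} {χ χ' : AddChar Λ ℂ} {P : Ideal (QuotJ X)} [hP : P.IsPrime]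
    (hχ' : P.comap (Ideal.Quotient.mk (idealJ X)) = pointIdeal χ')
    (h : RingHom.ker (algebraMap (QuotJ X) (LocQuotJ X χ)) ≤ P) : χ = χ' := by
  ext a
  obtain ⟨n, hn⟩ := isNilpotent_unipotentPart X χ a
  rw [unipotentPart, ← map_pow] at hn
  have h1 : (χ a)⁻¹ • expElt a - 1 ∈ pointIdeal χ' := by
    rw [← hχ']
    exact hP.mem_of_pow_mem n (h hn)
  rw [mem_pointIdeal, map_sub, map_smul, map_one, evalAt_expElt, smul_eq_mul, sub_eq_zero,
    inv_mul_eq_one₀ (addChar_ne_zero χ a)] at h1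
  exact h1

theorem isCoprime_ker_algebraMap {X : ι → Λ} {χ χ' : AddChar Λ ℂ} (h : χ ≠ χ') :
    IsCoprime (RingHom.ker (algebraMap (QuotJ X) (LocQuotJ X χ)))
      (RingHom.ker (algebraMap (QuotJ X) (LocQuotJ X χ'))) := by
  rw [Ideal.isCoprime_iff_sup_eq]
  by_contra hne
  obtain ⟨P, hP, hle⟩ := Ideal.exists_le_maximal _ hne
  have := hP.isPrime
  obtain ⟨χ'', -, hP'⟩ := exists_comap_eq_pointIdeal P
  exact h ((eq_of_ker_le hP' (le_sup_left.trans hle)).trans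
    (eq_of_ker_le hP' (le_sup_right.trans hle)).symm)

/-- `ℂ[Λ]/J_X` is the product of its localizations at the points of the arrangement. -/
def equivPiLoc (X : ι → Λ) : QuotJ X ≃ₐ[ℂ] ∀ χ : points X, LocQuotJ X χ.1 :=
  AlgEquiv.ofBijective
    (AlgHom.pi fun χ : points X => Algebra.algHom ℂ (QuotJ X) (LocQuotJ X χ.1)) <| by
    have := (finite_points X).to_subtype
    constructor
    · rw [injective_iff_map_eq_zero]
      exact fun x hx => eq_zero_of_forall_algebraMap_eq_zero fun χ hχ => congrFun hx ⟨χ, hχ⟩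
    · intro y
      -- The ring is Artinian, so each component lifts to it. The Chinese remainder theorem for the
      -- pairwise coprime kernels glues the lifts.
      choose z hz using fun χ : points X => algebraMap_locQuotJ_surjective X χ.1 (y χ)
      obtain ⟨x, hx⟩ := Ideal.exists_forall_sub_mem_ideal
        (I := fun χ : points X => RingHom.ker (algebraMap (QuotJ X) (LocQuotJ X χ.1)))
        (fun χ χ' h => isCoprime_ker_algebraMap fun h' => h (Subtype.ext h')) z
      refine ⟨x, funext fun χ => ?_⟩
      have h := hx χ
      rw [RingHom.mem_ker, map_sub, hz, sub_eq_zero] at h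
      exact h

end Decomposition

/-! ### The logarithm isomorphism at a point -/

section LogIso

variable {V : Type*} [NormedAddCommGroup V] [NormedSpace ℝ V] {Λ : Submodule ℤ V} {ι : Type*}

theorem linElt_add (v w : V) : linElt (v + w) = linElt v + linElt w := map_add (linEltₛₗ V) v w

/-- The class of a vector in `A_X`. -/
def linClass (X : ι → Λ) (v : V) : AlgA X := Ideal.Quotient.mk (idealI X) (linElt v)

theorem linClass_add (X : ι → Λ) (v w : V) :
    linClass X (v + w) = linClass X v + linClass X w := by
  rw [linClass, linElt_add, map_add]; rfl

theorem prod_linClass_eq_zero {X : ι → Λ} {Y : Finset ι} (hY : IsCocircuit X Y) :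
    ∏ i ∈ Y, linClass X (X i : V) = 0 := by
  simp only [linClass]
  rw [← map_prod, Ideal.Quotient.eq_zero_iff_mem]
  exact Ideal.subset_span ⟨Y, hY, rfl⟩

/-- For a prime `P` the vectors with class in `P` form a real subspace `T`. If the members of `X`
outside `T` formed a cocircuit, their product, which is zero, would put one of them in `T`. So the
members in `T` span `V`. -/
theorem isNilpotent_linClass [Finite ι] (X : ι → Λ) (v : V) : IsNilpotent (linClass X v) := by
  rw [nilpotent_iff_mem_prime]
  intro P hP
  let T : Submodule ℝ V := ((P.restrictScalars ℂ).comap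
    (Ideal.Quotient.mkₐ ℂ (idealI X)).toLinearMap).comap (linEltₛₗ V)
  have hT : ∀ v, v ∈ T ↔ linClass X v ∈ P := fun _ => Iff.rfl
  rw [← hT]
  have hfin : {i | (X i : V) ∉ T}.Finite := Set.toFinite _
  by_cases hY : IsCocircuit X hfin.toFinset
  · have h : ∏ i ∈ hfin.toFinset, linClass X (X i : V) ∈ P := by
      rw [prod_linClass_eq_zero hY]
      exact zero_mem P
    obtain ⟨i, hi, hiP⟩ := hP.prod_mem_iff.1 h
    exact ((hfin.mem_toFinset.1 hi) ((hT _).2 hiP)).elim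
  · rw [IsCocircuit, not_not] at hY
    have hle : Submodule.span ℝ ((fun i => (X i : V)) '' {i | i ∉ hfin.toFinset}) ≤ T := by
      rw [Submodule.span_le]
      rintro _ ⟨i, hi, rfl⟩
      by_contra h
      exact hi (hfin.mem_toFinset.2 h)
    rw [hY] at hle
    exact hle Submodule.mem_top

/-- Add all members on which `χ` is not `1`. Their factors `1 - e^{-a}` are units at `χ`, so the
relation for `Y` survives alone. -/
theorem exists_cocircuit_subList [Finite ι] {X : ι → Λ} {χ : AddChar Λ ℂ}
    {Y : Finset {i : ι // χ (X i) = 1}} (hY : IsCocircuit (subList X χ) Y) :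
    ∃ Z : Finset ι, (∀ i ∈ Z, χ (X i) ≠ 1) ∧
      ∃ h : Disjoint (Y.map (Function.Embedding.subtype _)) Z,
        IsCocircuit X ((Y.map (Function.Embedding.subtype _)).disjUnion Z h) := by
  have hfin : {i | χ (X i) ≠ 1}.Finite := Set.toFinite _
  refine ⟨hfin.toFinset, fun i hi => hfin.mem_toFinset.1 hi, ?_, ?_⟩
  · rw [Finset.disjoint_left]
    intro i hi hi'
    obtain ⟨j, -, rfl⟩ := Finset.mem_map.1 hi
    exact hfin.mem_toFinset.1 hi' j.2
  · intro h
    refine hY (eq_top_iff.2 (h ▸ Submodule.span_mono ?_))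
    rintro _ ⟨i, hi, rfl⟩
    have h1 : χ (X i) = 1 := by
      by_contra h1
      exact hi (Finset.mem_disjUnion.2 (Or.inr (hfin.mem_toFinset.2 h1)))
    refine ⟨⟨i, h1⟩, fun hiY => hi ?_, rfl⟩
    exact Finset.mem_disjUnion.2 (Or.inl (Finset.mem_map.2 ⟨_, hiY, rfl⟩))

theorem IsCocircuit.subtype {X : ι → Λ} {χ : AddChar Λ ℂ} {Y : Finset ι} (hY : IsCocircuit X Y)
    [DecidablePred fun i => χ (X i) = 1] :
    IsCocircuit (subList X χ) (Y.subtype fun i => χ (X i) = 1) := by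
  intro h
  refine hY (eq_top_iff.2 (h ▸ Submodule.span_mono ?_))
  rintro _ ⟨i, hi, rfl⟩
  exact ⟨i, fun hiY => hi (Finset.mem_subtype.2 hiY), rfl⟩

section Exponential

variable [Finite ι] (X : ι → Λ) (χ : AddChar Λ ℂ)

/-- The map `e^a ↦ χ(a) exp(a)`. -/
def expHom : AddMonoidAlgebra ℂ Λ →ₐ[ℂ] AlgA (subList X χ) :=
  AddMonoidAlgebra.lift ℂ (AlgA (subList X χ)) Λ
    { toFun a := χ a.toAdd • nilExp (linClass (subList X χ) (a.toAdd : V))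
      map_one' := by
        have h : linClass (subList X χ) (0 : V) = 0 := by
          have := linClass_add (subList X χ) (0 : V) 0
          rwa [add_zero, left_eq_add] at this
        rw [toAdd_one, χ.map_zero_eq_one, one_smul, Submodule.coe_zero, h, nilExp_zero]
      map_mul' a b := by
        rw [toAdd_mul, χ.map_add_eq_mul, Submodule.coe_add, linClass_add,
          nilExp_add (isNilpotent_linClass _ _) (isNilpotent_linClass _ _), smul_mul_smul_comm] }

theorem expHom_expElt (a : Λ) :
    expHom X χ (expElt a) = χ a • nilExp (linClass (subList X χ) (a : V)) := by
  rw [expHom, expElt, AddMonoidAlgebra.lift_single, one_smul]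
  rfl

theorem expHom_eq_zero {f : AddMonoidAlgebra ℂ Λ} (hf : f ∈ idealJ X) : expHom X χ f = 0 := by
  classical
  refine (Ideal.span_le (I := RingHom.ker (expHom X χ))).2 ?_ hf
  rintro _ ⟨Y, hY, rfl⟩
  have h0 := prod_linClass_eq_zero (hY.subtype (χ := χ))
  rw [SetLike.mem_coe, RingHom.mem_ker, map_prod, ← Finset.prod_filter_mul_prod_filter_not Y
    (fun i => χ (X i) = 1), ← Finset.prod_subtype_eq_prod_filter]
  refine mul_eq_zero_of_left ?_ _
  -- On `X_χ` each factor `1 - exp(-a)` is a multiple of `a`, and the product of these `a` vanishes.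
  refine zero_dvd_iff.1 (h0 ▸ Finset.prod_dvd_prod_of_dvd _ _ fun i _ => ?_)
  obtain ⟨u, -, hu⟩ := exists_nilExp_eq
    (isNilpotent_linClass (subList X χ) ((-X i : Λ) : V))
  have hneg : linClass (subList X χ) ((-X i : Λ) : V) =
      -linClass (subList X χ) (subList X χ i : V) := by
    rw [linClass, linClass, Submodule.coe_neg]
    exact congrArg _ (map_neg (linEltₛₗ V) _) |>.trans (map_neg _ _)
  rw [map_sub, map_one, expHom_expElt, addChar_neg, i.2, inv_one, one_smul, hu, hneg]
  exact ⟨u, by ring⟩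

/-- The image of `f` differs from the scalar `f(χ)` by a nilpotent. -/
theorem isUnit_expHom {f : AddMonoidAlgebra ℂ Λ} (hf : evalAt χ f ≠ 0) :
    IsUnit (expHom X χ f) := by
  have h : ∀ f, IsNilpotent (expHom X χ f - algebraMap ℂ _ (evalAt χ f)) := by
    intro f
    induction f using AddMonoidAlgebra.induction_linear with
    | zero => simp
    | add f g hf hg =>
      rw [map_add, map_add, map_add, add_sub_add_comm]
      exact Commute.isNilpotent_add (Commute.all _ _) hf hg
    | single a c =>
      have h : (AddMonoidAlgebra.single a c : AddMonoidAlgebra ℂ Λ) = c • expElt a := by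
        simp [expElt]
      have h1 := (isNilpotent_nilExp_sub_one (isNilpotent_linClass (subList X χ) (a : V))).smul
        (c * χ a)
      rw [h, map_smul, map_smul, expHom_expElt, evalAt_expElt, Algebra.algebraMap_eq_smul_one,
        smul_eq_mul, smul_smul, ← smul_sub]
      exact h1
  have h1 : IsUnit (algebraMap ℂ (AlgA (subList X χ)) (evalAt χ f)) :=
    (IsUnit.mk0 _ hf).map (algebraMap ℂ _)
  have h2 := IsNilpotent.isUnit_add_left_of_commute (h f) h1 (Commute.all _ _)
  rwa [add_sub_cancel] at h2

/-- The map `e^a ↦ χ(a) exp(a)` on the localization. -/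
def expLoc : LocQuotJ X χ →ₐ[ℂ] AlgA (subList X χ) :=
  IsLocalization.liftAlgHom (M := (pointIdeal χ).primeCompl.map (Ideal.Quotient.mk (idealJ X)))
    (f := Ideal.Quotient.liftₐ (idealJ X) (expHom X χ) fun _ hf => expHom_eq_zero X χ hf) (by
      rintro ⟨_, f, hf, rfl⟩
      exact isUnit_expHom X χ hf)

theorem expLoc_toLoc (f : AddMonoidAlgebra ℂ Λ) : expLoc X χ (toLoc X χ f) = expHom X χ f :=
  IsLocalization.lift_eq _ _

end Exponential

section Logarithm

variable [FiniteDimensional ℝ V] [DiscreteTopology Λ] [IsZLattice ℝ Λ] [Finite ι]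
variable (X : ι → Λ) (χ : AddChar Λ ℂ)

theorem logOneAdd_unipotentPart_add (a b : Λ) :
    logOneAdd (unipotentPart X χ (a + b)) =
      logOneAdd (unipotentPart X χ a) + logOneAdd (unipotentPart X χ b) := by
  refine logOneAdd_add (isNilpotent_unipotentPart X χ a) (isNilpotent_unipotentPart X χ b)
    (isNilpotent_unipotentPart X χ (a + b)) ?_
  rw [one_add_unipotentPart, one_add_unipotentPart, one_add_unipotentPart, expElt_add, map_mul,
    smul_mul_smul_comm, χ.map_add_eq_mul, mul_inv]

/-- A basis of `Λ` is also a real basis of `V`, so `F` can be prescribed on it. The formula extends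
to all of `Λ` because the logarithm is additive. -/
theorem exists_logHom : ∃ F : SymC V →ₐ[ℂ] LocQuotJ X χ,
    ∀ a : Λ, F (linElt (a : V)) = logOneAdd (unipotentPart X χ a) := by
  have : Module.Free ℤ Λ := ZLattice.module_free ℝ Λ
  let e := Module.Free.chooseBasis ℤ Λ
  let B := Algebra.TensorProduct.basis ℂ (e.ofZLatticeBasis ℝ Λ)
  let F : SymC V →ₐ[ℂ] LocQuotJ X χ :=
    SymmetricAlgebra.lift (B.constr ℂ fun j => logOneAdd (unipotentPart X χ (e j)))
  let F₁ : Λ →+ LocQuotJ X χ :=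
    AddMonoidHom.mk' (fun a => F (linElt (a : V))) fun a b => by
      rw [Submodule.coe_add, linElt_add, map_add]
  let F₂ : Λ →+ LocQuotJ X χ :=
    AddMonoidHom.mk' (fun a => logOneAdd (unipotentPart X χ a)) (logOneAdd_unipotentPart_add X χ)
  have h : F₁.toIntLinearMap = F₂.toIntLinearMap := by
    refine e.ext fun j => ?_
    change F (linElt (e j : V)) = logOneAdd (unipotentPart X χ (e j))
    have hj : (1 : ℂ) ⊗ₜ[ℝ] (e j : V) = B j := by
      rw [Algebra.TensorProduct.basis_apply, Module.Basis.ofZLatticeBasis_apply]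
    rw [linElt, SymmetricAlgebra.lift_ι_apply, hj, Module.Basis.constr_basis]
  exact ⟨F, fun a => DFunLike.congr_fun h a⟩

-- Enlarge the cocircuit to one of `X`, cancel the unit factors, and use that each `log(e^a)` is a
-- multiple of `1 - e^{-a}`.
variable {X χ} in
theorem logHom_eq_zero {F : SymC V →ₐ[ℂ] LocQuotJ X χ}
    (hF : ∀ a : Λ, F (linElt (a : V)) = logOneAdd (unipotentPart X χ a)) {x : SymC V}
    (hx : x ∈ idealI (subList X χ)) : F x = 0 := by
  refine (Ideal.span_le (I := RingHom.ker F)).2 ?_ hx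
  rintro _ ⟨Y, hY, rfl⟩
  obtain ⟨Z, hZ, hdisj, hYZ⟩ := exists_cocircuit_subList hY
  have h0 : toLoc X χ (∏ i ∈ (Y.map (Function.Embedding.subtype _)).disjUnion Z hdisj,
      (1 - expElt (-X i))) = 0 :=
    toLoc_eq_zero X χ (Ideal.subset_span ⟨_, hYZ, rfl⟩)
  rw [Finset.prod_disjUnion, map_mul, Finset.prod_map] at h0
  have hu : IsUnit (toLoc X χ (∏ i ∈ Z, (1 - expElt (-X i)))) := by
    refine isUnit_toLoc X ?_
    rw [map_prod, Finset.prod_ne_zero_iff]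
    intro i hi h
    rw [map_sub, map_one, evalAt_expElt, addChar_neg, sub_eq_zero, eq_comm, inv_eq_one] at h
    exact hZ i hi h
  rw [hu.mul_left_eq_zero, map_prod] at h0
  rw [SetLike.mem_coe, RingHom.mem_ker, map_prod]
  refine zero_dvd_iff.1 (h0 ▸ Finset.prod_dvd_prod_of_dvd _ _ fun i _ => ?_)
  obtain ⟨u, -, hu⟩ := exists_logOneAdd_eq (isNilpotent_unipotentPart X χ (X i))
  have h2 : unipotentPart X χ (X i) = toLoc X χ (1 - expElt (-X i)) * toLoc X χ (expElt (X i)) := by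
    rw [unipotentPart_eq, i.2, inv_one, one_smul, ← map_mul]
    congr 1
    linear_combination expElt_neg_mul (X i)
  have h3 : F (linElt (subList X χ i : V)) = _ := hF (X i)
  rw [h3, hu, h2, mul_assoc]
  exact Dvd.intro _ rfl

theorem expLoc_logOneAdd (a : Λ) :
    expLoc X χ (logOneAdd (unipotentPart X χ a)) = linClass (subList X χ) (a : V) := by
  have hn := isNilpotent_unipotentPart X χ a
  have hl := isNilpotent_logOneAdd hn
  refine nilExp_inj (hl.map (expLoc X χ)) (isNilpotent_linClass _ _) ?_
  rw [← map_nilExp _ hl, nilExp_logOneAdd hn, one_add_unipotentPart, map_smul, expLoc_toLoc,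
    expHom_expElt, smul_smul, inv_mul_cancel₀ (addChar_ne_zero χ a), one_smul]

theorem exists_logEquiv : ∃ L : AlgA (subList X χ) ≃ₐ[ℂ] LocQuotJ X χ,
    ∀ a : Λ, L (Ideal.Quotient.mk (idealI (subList X χ)) (linElt (a : V))) =
      logOneAdd (unipotentPart X χ a) := by
  obtain ⟨F, hF⟩ := exists_logHom X χ
  let L : AlgA (subList X χ) →ₐ[ℂ] LocQuotJ X χ :=
    Ideal.Quotient.liftₐ _ F fun _ hx => logHom_eq_zero hF hx
  have hL : ∀ a : Λ, L (linClass (subList X χ) (a : V)) = logOneAdd (unipotentPart X χ a) := hF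
  have h1 : ∀ f, L (expHom X χ f) = toLoc X χ f := by
    have h : L.comp (expHom X χ) = toLoc X χ := by
      refine (AddMonoidAlgebra.lift ℂ (LocQuotJ X χ) Λ).symm.injective (MonoidHom.ext fun a => ?_)
      induction a using Multiplicative.rec with | ofAdd a
      change L (expHom X χ (expElt a)) = toLoc X χ (expElt a)
      rw [expHom_expElt, map_smul, map_nilExp _ (isNilpotent_linClass _ _), hL,
        nilExp_logOneAdd (isNilpotent_unipotentPart X χ a), one_add_unipotentPart, smul_smul,
        mul_inv_cancel₀ (addChar_ne_zero χ a), one_smul]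
    exact fun f => DFunLike.congr_fun h f
  have h2 : ∀ x, L (expLoc X χ x) = x := by
    intro x
    obtain ⟨f, g, hg, h⟩ := exists_toLoc_eq_mul X χ x
    refine (isUnit_toLoc X hg).mul_left_injective ?_
    change L (expLoc X χ x) * toLoc X χ g = x * toLoc X χ g
    have h3 := congrArg (fun y => L (expLoc X χ y)) h
    simp only [map_mul, expLoc_toLoc, h1] at h3
    rw [h3, h]
  have h4 : ∀ y, expLoc X χ (L y) = y := by
    have h : (expLoc X χ).comp L = AlgHom.id ℂ _ := by
      have : Module.Free ℤ Λ := ZLattice.module_free ℝ Λ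
      let e := Module.Free.chooseBasis ℤ Λ
      let B := Algebra.TensorProduct.basis ℂ (e.ofZLatticeBasis ℝ Λ)
      refine Ideal.Quotient.algHom_ext _ (SymmetricAlgebra.algHom_ext (B.ext fun j => ?_))
      have hj : B j = (1 : ℂ) ⊗ₜ[ℝ] (e j : V) := by
        rw [Algebra.TensorProduct.basis_apply, Module.Basis.ofZLatticeBasis_apply]
      rw [hj]
      change expLoc X χ (L (linClass (subList X χ) (e j : V))) = linClass (subList X χ) (e j : V)
      rw [hL, expLoc_logOneAdd]
    exact fun y => DFunLike.congr_fun h y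
  exact ⟨AlgEquiv.ofBijective L ⟨Function.LeftInverse.injective h4,
    Function.RightInverse.surjective h2⟩, hF⟩

end Logarithm

end LogIso

/-! ### Difference equations, duality and the count `δ(X)` -/

section Dimension

variable {V : Type*} [NormedAddCommGroup V] {Λ : Submodule ℤ V} {ι : Type*}

/-- The linear functional on the group algebra with values `f a` at `e^a`. -/
def functional {G : Type*} (f : G → ℂ) : AddMonoidAlgebra ℂ G →ₗ[ℂ] ℂ :=
  Finsupp.linearCombination ℂ f ∘ₗ (AddMonoidAlgebra.coeffLinearEquiv ℂ).toLinearMap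

theorem functional_single {G : Type*} (f : G → ℂ) (a : G) (c : ℂ) :
    functional f (AddMonoidAlgebra.single a c) = c * f a := by
  simp [functional]

theorem functional_expElt (f : Λ → ℂ) (a : Λ) : functional f (expElt a) = f a := by
  rw [expElt, functional_single, one_mul]

/-- On `e^u` both sides are `f u - f (u - a)`: multiplication by `1 - e^{-a}` is the transpose of
`∇_a`. -/
theorem functional_one_sub_expElt_mul (f : Λ → ℂ) (a : Λ) (g : AddMonoidAlgebra ℂ Λ) :
    functional f ((1 - expElt (-a)) * g) = functional (nabla a f) g := by
  induction g using AddMonoidAlgebra.induction_linear with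
  | zero => simp
  | add g h hg hh => rw [mul_add, map_add, map_add, hg, hh]
  | single u c =>
    rw [sub_mul, one_mul, map_sub, expElt, AddMonoidAlgebra.single_mul_single, functional_single,
      functional_single, functional_single, one_mul, neg_add_eq_sub]
    change _ = c * (f u - f (u - a))
    ring

theorem nablaProd_empty (X : ι → Λ) : nablaProd X ∅ = 1 :=
  Finset.noncommProd_empty _ _

theorem nablaProd_insert [DecidableEq ι] (X : ι → Λ) {Y : Finset ι} {i : ι} (hi : i ∉ Y) :
    nablaProd X (insert i Y) = nabla (X i) * nablaProd X Y :=
  Finset.noncommProd_insert_of_notMem _ _ _ _ hi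

theorem functional_prod_mul (X : ι → Λ) (Y : Finset ι) (f : Λ → ℂ) (g : AddMonoidAlgebra ℂ Λ) :
    functional f ((∏ i ∈ Y, (1 - expElt (-X i))) * g) = functional (nablaProd X Y f) g := by
  classical
  induction Y using Finset.induction_on generalizing g with
  | empty => rw [Finset.prod_empty, one_mul, nablaProd_empty, Module.End.one_apply]
  | insert i Y hi ih =>
    rw [Finset.prod_insert hi, mul_assoc, mul_left_comm, ih, functional_one_sub_expElt_mul,
      nablaProd_insert X hi, Module.End.mul_apply]

variable [NormedSpace ℝ V]

theorem isExtractedBasis_map_iff {X : ι → Λ} {χ : AddChar Λ ℂ}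
    {b : Finset {i : ι // χ (X i) = 1}} :
    IsExtractedBasis X (b.map (Function.Embedding.subtype _)) ↔
      IsExtractedBasis (subList X χ) b := by
  have himage : ((fun i => (X i : V)) '' (b.map (Function.Embedding.subtype _) : Set ι)) =
      (fun i => (subList X χ i : V)) '' (b : Set {i : ι // χ (X i) = 1}) := by
    rw [Finset.coe_map, Set.image_image]
    rfl
  rw [IsExtractedBasis, IsExtractedBasis, himage]
  refine and_congr_left fun _ => ⟨fun h => ?_, fun h => ?_⟩
  · exact h.comp (fun i : b => ⟨i.1.1, Finset.mem_map.2 ⟨i.1, i.2, rfl⟩⟩) fun i j hij =>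
      Subtype.ext (Subtype.ext (congrArg
        (fun k : ↥(b.map (Function.Embedding.subtype fun i => χ (X i) = 1)) => (k : ι)) hij))
  · have h' : LinearIndepOn ℝ ((fun i => (X i : V)) ∘ Subtype.val)
        (b : Set {i : ι // χ (X i) = 1}) := h
    have h'' := LinearIndepOn.image_of_comp _ _ h'
    have hc : (b.map (Function.Embedding.subtype _) : Set ι) =
        Subtype.val '' (b : Set {i : ι // χ (X i) = 1}) := by
      rw [Finset.coe_map]; rfl
    rw [← hc] at h''
    exact h''

open scoped Classical in
theorem card_basesIn_subList [Fintype ι] (X : ι → Λ) (χ : AddChar Λ ℂ) :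
    (basesIn ℝ (fun i => (subList X χ i : V)) Finset.univ).card =
      (Finset.univ.filter fun b : Finset ι => IsExtractedBasis X b ∧ χ ∈ trivialOn X b).card := by
  rw [← Finset.card_map (Finset.mapEmbedding (Function.Embedding.subtype _)).toEmbedding]
  congr 1
  ext b
  simp only [Finset.mem_map, mem_basesIn_univ_iff, Finset.mem_filter, Finset.mem_univ, true_and]
  constructor
  · rintro ⟨b, hb, rfl⟩
    refine ⟨isExtractedBasis_map_iff.2 hb, fun i hi => ?_⟩
    obtain ⟨j, -, rfl⟩ := Finset.mem_map.1 hi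
    exact j.2
  · rintro ⟨hb, hχ⟩
    have hmap := Finset.subtype_map_of_mem (p := fun i => χ (X i) = 1) hχ
    exact ⟨b.subtype fun i => χ (X i) = 1, isExtractedBasis_map_iff.1 (by rwa [hmap]), hmap⟩

theorem mem_solutions_iff {X : ι → Λ} {f : Λ → ℂ} :
    f ∈ solutions X ↔ ∀ x ∈ idealJ X, functional f x = 0 := by
  simp only [solutions, Submodule.mem_iInf, LinearMap.mem_ker]
  constructor
  · intro h x hx
    -- The multiplier `g` carries the induction through multiples of the generators, since
    -- `functional f` is only linear.
    have key : ∀ g, functional f (g * x) = 0 := by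
      induction hx using Submodule.span_induction with
      | mem x hx =>
        obtain ⟨Y, hY, rfl⟩ := hx
        intro g
        rw [mul_comm, functional_prod_mul, h Y hY]
        simp [functional]
      | zero => simp
      | add x y _ _ hx hy => intro g; rw [mul_add, map_add, hx, hy, add_zero]
      | smul c x _ hx => intro g; rw [smul_eq_mul, ← mul_assoc]; exact hx _
    simpa using key 1
  · intro h Y hY
    funext u
    rw [← functional_expElt (nablaProd X Y f) u, ← functional_prod_mul]
    exact h _ (Ideal.mul_mem_right _ _ (Ideal.subset_span ⟨Y, hY, rfl⟩))

/-- The values of a linear functional on `ℂ[Λ]/J_X` at the elements `e^a`. -/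
def valuesMap (X : ι → Λ) : Module.Dual ℂ (QuotJ X) →ₗ[ℂ] Λ → ℂ where
  toFun ψ a := ψ (Ideal.Quotient.mk (idealJ X) (expElt a))
  map_add' _ _ := rfl
  map_smul' _ _ := rfl

theorem functional_valuesMap (X : ι → Λ) (ψ : Module.Dual ℂ (QuotJ X))
    (x : AddMonoidAlgebra ℂ Λ) :
    functional (valuesMap X ψ) x = ψ (Ideal.Quotient.mk (idealJ X) x) := by
  induction x using AddMonoidAlgebra.induction_linear with
  | zero => simp
  | add g h hg hh => rw [map_add, map_add, map_add, hg, hh]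
  | single u c =>
    have h : (AddMonoidAlgebra.single u c : AddMonoidAlgebra ℂ Λ) = c • expElt u := by
      simp [expElt]
    rw [h, map_smul, functional_expElt]
    exact (map_smul ψ c _).symm

theorem valuesMap_injective (X : ι → Λ) : Function.Injective (valuesMap X) := by
  intro ψ ψ' h
  refine LinearMap.ext fun x => ?_
  obtain ⟨x, rfl⟩ := Ideal.Quotient.mk_surjective x
  rw [← functional_valuesMap, ← functional_valuesMap, h]

theorem range_valuesMap (X : ι → Λ) : LinearMap.range (valuesMap X) = solutions X := by
  ext f
  rw [mem_solutions_iff]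
  constructor
  · rintro ⟨ψ, rfl⟩ x hx
    rw [functional_valuesMap, Ideal.Quotient.eq_zero_iff_mem.2 hx, map_zero]
  · intro h
    let ψ : Module.Dual ℂ (QuotJ X) :=
      Submodule.liftQ ((idealJ X).restrictScalars ℂ) (functional f) h ∘ₗ
        (Submodule.Quotient.restrictScalarsEquiv ℂ (idealJ X)).symm.toLinearMap
    exact ⟨ψ, funext fun a => functional_expElt f a⟩

/-- The solutions of the difference equations are the linear functionals on `ℂ[Λ]/J_X`. -/
def dualEquivSolutions (X : ι → Λ) : Module.Dual ℂ (QuotJ X) ≃ₗ[ℂ] solutions X :=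
  (LinearEquiv.ofInjective _ (valuesMap_injective X)).trans
    (LinearEquiv.ofEq _ _ (range_valuesMap X))

theorem finite_solutions (X : ι → Λ) [Module.Finite ℂ (QuotJ X)] :
    Module.Finite ℂ (solutions X) ∧
      Module.finrank ℂ (solutions X) = Module.finrank ℂ (QuotJ X) :=
  ⟨Module.Finite.equiv (dualEquivSolutions X),
    (dualEquivSolutions X).finrank_eq.symm.trans Subspace.dual_finrank_eq⟩

theorem finrank_eq_sum {K R P : Type*} [Field K] [AddCommGroup R] [Module K R] [Fintype P]
    {A : P → Type*} [∀ χ, AddCommGroup (A χ)] [∀ χ, Module K (A χ)]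
    [∀ χ, Module.Finite K (A χ)] (Φ : R ≃ₗ[K] ∀ χ, A χ) :
    Module.finrank K R = ∑ χ, Module.finrank K (A χ) := by
  rw [Φ.finrank_eq, Module.finrank_pi_fintype]

/-- Count the pairs `(χ, b)` with `χ` trivial on the basis `b` in two ways. -/
theorem sum_card_trivialOn [FiniteDimensional ℝ V] [DiscreteTopology Λ] [IsZLattice ℝ Λ]
    {s N : ℕ} (e : Module.Basis (Fin s) ℤ Λ) (X : Fin N → Λ) [Fintype (points X)] :
    ∑ χ : points X, (basesIn ℝ (fun i => (subList X χ.1 i : V)) Finset.univ).card =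
      delta e X := by
  classical
  rw [delta]
  calc ∑ χ : points X, (basesIn ℝ (fun i => (subList X χ.1 i : V)) Finset.univ).card
      = ∑ χ : points X, ((Finset.univ.filter fun b => IsExtractedBasis X b).bipartiteAbove
          (fun χ b => χ.1 ∈ trivialOn X b) χ).card := by
        refine Finset.sum_congr rfl fun χ _ => ?_
        rw [card_basesIn_subList, Finset.bipartiteAbove, Finset.filter_filter]
    _ = ∑ b with IsExtractedBasis X b, ((Finset.univ : Finset (points X)).bipartiteBelow
          (fun χ b => χ.1 ∈ trivialOn X b) b).card :=
        Finset.sum_card_bipartiteAbove_eq_sum_card_bipartiteBelow _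
    _ = ∑ b with IsExtractedBasis X b, absDet e X b := by
        refine Finset.sum_congr rfl fun b hb => ?_
        have hb' := (Finset.mem_filter.1 hb).2
        rw [absDet_eq_card_quotient e hb', ← (card_trivialOn hb').2, Finset.bipartiteBelow,
          ← Fintype.card_subtype, ← Nat.card_eq_fintype_card]
        -- A character trivial on a basis is a point, so restricting to `points X` loses none.
        exact Nat.card_congr (Equiv.subtypeSubtypeEquivSubtype fun h => ⟨b, hb', h⟩)

end Dimension

end ToricArrangement

end

theorem mainTheorem6 {V : Type*} [NormedAddCommGroup V] [NormedSpace ℝ V] [FiniteDimensional ℝ V]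
    (Λ : Submodule ℤ V) [DiscreteTopology Λ] [IsZLattice ℝ Λ]
    {s N : ℕ} (e : Module.Basis (Fin s) ℤ Λ) (X : Fin N → Λ)
    (hX0 : ∀ i, X i ≠ 0)
    (hXspan : Submodule.span ℝ (Set.range fun i => (X i : V)) = ⊤) :
    -- the arrangement has finitely many points
    (ToricArrangement.points X).Finite ∧
    -- the logarithm isomorphisms at the points, and the resulting decomposition
    (∀ χ ∈ ToricArrangement.points X, ∀ a : Λ,
      IsNilpotent (ToricArrangement.unipotentPart X χ a)) ∧
    (∃ (L : ∀ χ : ToricArrangement.points X,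
          ToricArrangement.AlgA (ToricArrangement.subList X χ.1) ≃ₐ[ℂ]
            ToricArrangement.LocQuotJ X χ.1)
        (Φ : ToricArrangement.QuotJ X ≃ₐ[ℂ]
          (∀ χ : ToricArrangement.points X,
            ToricArrangement.AlgA (ToricArrangement.subList X χ.1))),
      (∀ (χ : ToricArrangement.points X) (a : Λ),
        L χ (Ideal.Quotient.mk (ToricArrangement.idealI (ToricArrangement.subList X χ.1))
            (ToricArrangement.linElt (a : V))) =
          ToricArrangement.logOneAdd (ToricArrangement.unipotentPart X χ.1 a)) ∧
      (∀ (x : ToricArrangement.QuotJ X) (χ : ToricArrangement.points X),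
        L χ (Φ x χ) =
          algebraMap (ToricArrangement.QuotJ X) (ToricArrangement.LocQuotJ X χ.1) x)) ∧
    -- the dimensions
    (Module.Finite ℂ (ToricArrangement.QuotJ X) ∧
      Module.finrank ℂ (ToricArrangement.QuotJ X) = ToricArrangement.delta e X) ∧
    (Module.Finite ℂ (ToricArrangement.solutions X) ∧
      Module.finrank ℂ (ToricArrangement.solutions X) = ToricArrangement.delta e X) := by
  classical
  have hfin := ToricArrangement.finite_quotJ X
  have := (ToricArrangement.finite_points X).fintype
  choose L hL using fun χ : ToricArrangement.points X => ToricArrangement.exists_logEquiv X χ.1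
  let Φ := (ToricArrangement.equivPiLoc X).trans (AlgEquiv.piCongrRight fun χ => (L χ).symm)
  have hdim : Module.finrank ℂ (ToricArrangement.QuotJ X) = ToricArrangement.delta e X := by
    rw [ToricArrangement.finrank_eq_sum Φ.toLinearEquiv, ← ToricArrangement.sum_card_trivialOn e X]
    exact Finset.sum_congr rfl fun χ _ => ToricArrangement.finrank_AlgA _
  obtain ⟨hsol, hsoldim⟩ := ToricArrangement.finite_solutions X
  exact ⟨ToricArrangement.finite_points X,
    fun χ _ a => ToricArrangement.isNilpotent_unipotentPart X χ a,
    ⟨L, Φ, hL, fun x χ => (L χ).apply_symm_apply _⟩, ⟨hfin, hdim⟩, hsol, hsoldim.trans hdim⟩
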